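/- Let $(M^2,g)$ be a connected oriented smooth surface with a smooth Riemannian metric, let $K$ be its Gaussian curvature, and let $c$ be a non-zero real constant. Consider the following two conditions. (A$_c$) Around every point of $M$ there exist positively oriented local coordinates $(u,v)$ in which $$g(u,v)=du^2+\frac{1}{f^{3/2}(u)}\,dv^2,$$ where $f=f(u)$ is some positive smooth solution, with $f'(u)>0$, of the second order ODE $$f''f-\frac74\,(f')^2+\frac43 f^2+4f^4+\frac43c^2f^5=0 .$$ (B$_c$) At every point of $M$ one has $1+K<0$ and $\operatorname{grad}K\neq0$, and the level curves of $K$ are circles of $M$ with positive constant signed curvature $$\kappa=-\frac14\,\frac{|\operatorname{grad}K|}{K+f^2+1},$$ where now $f:M\to\mathbb R$ is the function whose value at each point is the unique positive root of $1+K+3f^2+c^2f^3=0$. Here a level curve of $K$ is parametrized by arc length and oriented so that $(\operatorname{grad}K,\gamma')$ is positively oriented, and a unit speed curve $\gamma$ is a circle of signed curvature $\kappa$ if $\kappa$ is constant along $\gamma$ and $\nabla_{\gamma'}\gamma'=\kappa N$, $\nabla_{\gamma'}N=-\kappa\gamma'$, where $\nabla$ is the Levi-Civita connection and $N$ is the unit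 normal field along $\gamma$ such that $(\gamma',N)$ is positively oriented. Then (A$_c$) holds if and only if (B$_c$) holds, for every $c\ne0$. Moreover, around every point of $M$ there exist coordinates as in (A$_c$) with some non-zero constant $c$ (which may a priori depend on the point) if and only if (B$_c$) holds for some non-zero constant $c$. -/

import Mathlib

open Set Bundle
open scoped Manifold ContDiff

noncomputable section

namespace BiconservativeSurface

/-- The coordinate plane `ℝ²`, with coordinates `x 0 = u` and `x 1 = v`. -/
abbrev Plane : Type := EuclideanSpace ℝ (Fin 2)

/-! ### Local Riemannian geometry of a metric `G = (g_ij)` on an open set of the plane -/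

/-- The partial derivative `∂h/∂xⁱ`. -/
def partialDeriv (i : Fin 2) (h : Plane → ℝ) (x : Plane) : ℝ :=
  fderiv ℝ h x (EuclideanSpace.single i 1)

/-- The Christoffel symbol
`Γᵏᵢⱼ = ½ ∑ₗ gᵏˡ (∂ᵢ gⱼₗ + ∂ⱼ gᵢₗ − ∂ₗ gᵢⱼ)` of the Levi-Civita connection. -/
def christoffel (G : Plane → Matrix (Fin 2) (Fin 2) ℝ) (k i j : Fin 2) (x : Plane) : ℝ :=
  (1 / 2) * ∑ l, (G x)⁻¹ k l *
    (partialDeriv i (fun y => G y j l) x + partialDeriv j (fun y => G y i l) x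
      - partialDeriv l (fun y => G y i j) x)

/-- The component `Rˡ` in `R(∂ᵢ, ∂ⱼ)∂ₖ = ∑ₗ Rˡ ∂ₗ`, where
`R(X, Y)Z = ∇_X ∇_Y Z − ∇_Y ∇_X Z − ∇_[X,Y] Z`. -/
def riemannCoeff (G : Plane → Matrix (Fin 2) (Fin 2) ℝ) (l k i j : Fin 2) (x : Plane) : ℝ :=
  partialDeriv i (christoffel G l j k) x - partialDeriv j (christoffel G l i k) x
    + ∑ m, (christoffel G l i m x * christoffel G m j k x
      - christoffel G l j m x * christoffel G m i k x)

/-- The Gaussian curvature `⟨R(∂₀, ∂₁)∂₁, ∂₀⟩ / det G`. -/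
def curvatureOfCoeff (G : Plane → Matrix (Fin 2) (Fin 2) ℝ) (x : Plane) : ℝ :=
  (∑ l, G x l 0 * riemannCoeff G l 1 0 1 x) / (G x).det

/-! ### Oriented surfaces -/

section Orientation

variable (M : Type*) [TopologicalSpace M] [ChartedSpace Plane M]

/-- The given atlas orients `M`: all its transition maps have positive Jacobian determinant. -/
def IsOrientedAtlas : Prop :=
  ∀ e ∈ atlas Plane M, ∀ e' ∈ atlas Plane M, ∀ x ∈ (e.symm ≫ₕ e').source,
    0 < (fderiv ℝ (e.symm ≫ₕ e') x).det

variable {M}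

/-- `e` is a positively oriented smooth local chart of `M`. -/
def IsPositiveChart (e : OpenPartialHomeomorph M Plane) : Prop :=
  e ∈ IsManifold.maximalAtlas (𝓡 2) ∞ M ∧
    ∀ e' ∈ atlas Plane M, ∀ x ∈ (e.symm ≫ₕ e').source,
      0 < (fderiv ℝ (e.symm ≫ₕ e') x).det

/-- The coordinates of a tangent vector at `p` in the chart `e` around `p`. -/
def vecCoord (e : OpenPartialHomeomorph M Plane) (p : M) (w : TangentSpace (𝓡 2) p) : Plane :=
  mfderiv (𝓡 2) (𝓡 2) e p w

/-- `(w, z)` is a positively oriented basis of `T_p M`. -/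
def IsPositivePair (p : M) (w z : TangentSpace (𝓡 2) p) : Prop :=
  0 < vecCoord (chartAt Plane p) p w 0 * vecCoord (chartAt Plane p) p z 1
    - vecCoord (chartAt Plane p) p w 1 * vecCoord (chartAt Plane p) p z 0

/-- The velocity `γ'(t)`. -/
def velocity (γ : ℝ → M) (t : ℝ) : TangentSpace (𝓡 2) (γ t) :=
  mfderiv 𝓘(ℝ, ℝ) (𝓡 2) γ t (1 : ℝ)

end Orientation

/-! ### Riemannian surfaces -/

/-- Smooth Riemannian metrics on the surface `M`. -/
abbrev SurfaceMetric (M : Type*) [TopologicalSpace M] [ChartedSpace Plane M]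
    [IsManifold (𝓡 2) ∞ M] : Type _ :=
  ContMDiffRiemannianMetric (𝓡 2) ∞ Plane (fun p : M => TangentSpace (𝓡 2) p)

section Metric

variable {M : Type*} [TopologicalSpace M] [ChartedSpace Plane M] [IsManifold (𝓡 2) ∞ M]

/-- The matrix `(g(∂ᵢ, ∂ⱼ))` of the metric in the chart `e`, as a function of the coordinates. -/
def metricCoeff (g : SurfaceMetric M) (e : OpenPartialHomeomorph M Plane) (x : Plane) :
    Matrix (Fin 2) (Fin 2) ℝ :=
  Matrix.of fun i j =>
    g.inner (e.symm x) (mfderiv (𝓡 2) (𝓡 2) e.symm x (EuclideanSpace.single i (1 : ℝ)))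
      (mfderiv (𝓡 2) (𝓡 2) e.symm x (EuclideanSpace.single j (1 : ℝ)))

/-- The Gaussian curvature `K` of `(M, g)`. -/
def gaussianCurvature (g : SurfaceMetric M) (p : M) : ℝ :=
  curvatureOfCoeff (metricCoeff g (chartAt Plane p)) (chartAt Plane p p)

theorem exists_gradient (g : SurfaceMetric M) (h : M → ℝ) (p : M) :
    ∃ w : TangentSpace (𝓡 2) p, ∀ z : TangentSpace (𝓡 2) p,
      g.inner p w z = mfderiv (𝓡 2) 𝓘(ℝ, ℝ) h p z := by
  let E := TangentSpace (𝓡 2) p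
  have : FiniteDimensional ℝ E := inferInstanceAs (FiniteDimensional ℝ Plane)
  let L : E →ₗ[ℝ] Module.Dual ℝ E :=
    { toFun := fun w => (g.inner p w).toLinearMap
      map_add' := fun a b => by ext z; simp
      map_smul' := fun r a => by ext z; simp }
  have hinj : Function.Injective L := by
    refine (injective_iff_map_eq_zero L).2 fun w hw => ?_
    by_contra hne
    have h1 : L w w = 0 := by rw [hw]; rfl
    exact (g.pos p w hne).ne' h1
  have hsurj : Function.Surjective L :=
    (LinearMap.injective_iff_surjective_of_finrank_eq_finrank
      (Subspace.dual_finrank_eq (K := ℝ) (V := E)).symm).1 hinj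
  obtain ⟨w, hw⟩ := hsurj (mfderiv (𝓡 2) 𝓘(ℝ, ℝ) h p).toLinearMap
  exact ⟨w, fun z => LinearMap.congr_fun hw z⟩

/-- The gradient of `h` at `p`: the vector with `g(grad h, z) = dh(z)` for all `z`. -/
def gradient (g : SurfaceMetric M) (h : M → ℝ) (p : M) : TangentSpace (𝓡 2) p :=
  Classical.choose (exists_gradient g h p)

theorem gradient_spec (g : SurfaceMetric M) (h : M → ℝ) (p : M) (z : TangentSpace (𝓡 2) p) :
    g.inner p (gradient g h p) z = mfderiv (𝓡 2) 𝓘(ℝ, ℝ) h p z :=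
  Classical.choose_spec (exists_gradient g h p) z

/-- The length of a tangent vector. -/
def vecNorm (g : SurfaceMetric M) {p : M} (w : TangentSpace (𝓡 2) p) : ℝ :=
  Real.sqrt (g.inner p w w)

/-- The Levi-Civita covariant derivative `∇_{γ'} V` at the parameter `t` of a vector field `V`
along the curve `γ`, with components `(Vᵏ)' + ∑ᵢⱼ Γᵏᵢⱼ (xⁱ)' Vʲ` in a chart around `γ t`. -/
def covDerivAlong (g : SurfaceMetric M) (γ : ℝ → M)
    (V : ∀ s : ℝ, TangentSpace (𝓡 2) (γ s)) (t : ℝ) : TangentSpace (𝓡 2) (γ t) :=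
  let e := chartAt Plane (γ t)
  (mfderiv (𝓡 2) (𝓡 2) e (γ t)).inverse
    (WithLp.toLp 2 fun k : Fin 2 =>
      deriv (fun s => vecCoord e (γ s) (V s) k) t
        + ∑ i, ∑ j, christoffel (metricCoeff g e) k i j (e (γ t))
            * deriv (fun s => e (γ s) i) t * vecCoord e (γ t) (V t) j)

/-- On `(a, b)` the curve `γ` is a circle of constant signed curvature `k`: it is parametrized by
arc length and satisfies `∇_{γ'} γ' = k N` and `∇_{γ'} N = -k γ'`, where `N` is the unit normal
field for which `(γ', N)` is positively oriented. -/
def IsCircleOn (g : SurfaceMetric M) (γ : ℝ → M) (a b k : ℝ) : Prop :=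
  ∃ N : ∀ t : ℝ, TangentSpace (𝓡 2) (γ t), ∀ t ∈ Ioo a b,
    vecNorm g (velocity γ t) = 1 ∧
    vecNorm g (N t) = 1 ∧
    g.inner (γ t) (velocity γ t) (N t) = 0 ∧
    IsPositivePair (γ t) (velocity γ t) (N t) ∧
    covDerivAlong g γ (velocity γ) t = k • N t ∧
    covDerivAlong g γ N t = -k • velocity γ t

/-- On `(a, b)` the curve `γ` is an (arc of an) oriented level curve of `h`: it is smooth,
parametrized by arc length, `h` is constant along it, and `(grad h, γ')` is positively oriented. -/
structure IsLevelCurveOn (g : SurfaceMetric M) (h : M → ℝ) (γ : ℝ → M) (a b : ℝ) : Prop where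
  nonempty : a < b
  smooth : ContMDiffOn 𝓘(ℝ, ℝ) (𝓡 2) ∞ γ (Ioo a b)
  level : ∃ s : ℝ, ∀ t ∈ Ioo a b, h (γ t) = s
  unit_speed : ∀ t ∈ Ioo a b, vecNorm g (velocity γ t) = 1
  oriented : ∀ t ∈ Ioo a b, IsPositivePair (γ t) (gradient g h (γ t)) (velocity γ t)

/-- On the open set `J` the function `f` is a smooth positive solution, with `f' > 0`, of
`f f'' - (7/4) (f')² + (4/3) f² + 4 f⁴ + (4/3) c² f⁵ = 0`. -/
structure IsProfileOn (c : ℝ) (f : ℝ → ℝ) (J : Set ℝ) : Prop where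
  smooth : ContDiffOn ℝ ∞ f J
  pos : ∀ u ∈ J, 0 < f u
  deriv_pos : ∀ u ∈ J, 0 < deriv f u
  ode : ∀ u ∈ J, deriv (deriv f) u * f u - 7 / 4 * deriv f u ^ 2 + 4 / 3 * f u ^ 2
    + 4 * f u ^ 4 + 4 / 3 * c ^ 2 * f u ^ 5 = 0

/-- Around `p` there are positively oriented local coordinates `(u, v)` in which
`g = du² + f(u)^(-3/2) dv²`, with `f` as in `IsProfileOn`. -/
def HasNormalFormAt (g : SurfaceMetric M) (c : ℝ) (p : M) : Prop :=
  ∃ (e : OpenPartialHomeomorph M Plane) (f : ℝ → ℝ),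
    p ∈ e.source ∧ IsPositiveChart e ∧
    IsProfileOn c f ((fun x : Plane => x 0) '' e.target) ∧
    ∀ x ∈ e.target, metricCoeff g e x = !![1, 0; 0, 1 / f (x 0) ^ (3 / 2 : ℝ)]

/-- `y` is the unique positive root of `1 + K + 3 y² + c² y³ = 0`. -/
def IsUniquePositiveRoot (c K y : ℝ) : Prop :=
  (0 < y ∧ 1 + K + 3 * y ^ 2 + c ^ 2 * y ^ 3 = 0) ∧
    ∀ z : ℝ, 0 < z → 1 + K + 3 * z ^ 2 + c ^ 2 * z ^ 3 = 0 → z = y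

/-- `1 + K < 0`, `grad K ≠ 0`, and each level curve of `K` is a circle of positive constant signed
curvature `κ = -|grad K| / (4 (K + f² + 1))`, where `f` is the positive root of
`1 + K + 3 f² + c² f³ = 0`. -/
def HasCircularLevelCurves (g : SurfaceMetric M) (c : ℝ) : Prop :=
  (∀ p, 1 + gaussianCurvature g p < 0) ∧
  (∀ p, gradient g (gaussianCurvature g) p ≠ 0) ∧
  ∃ f : M → ℝ, (∀ p, IsUniquePositiveRoot c (gaussianCurvature g p) (f p)) ∧
    ∀ (γ : ℝ → M) (a b : ℝ), IsLevelCurveOn g (gaussianCurvature g) γ a b →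
      ∃ κ : ℝ, 0 < κ ∧ IsCircleOn g γ a b κ ∧
        ∀ t ∈ Ioo a b, κ = -(1 / 4) * (vecNorm g (gradient g (gaussianCurvature g) (γ t))
          / (gaussianCurvature g (γ t) + f (γ t) ^ 2 + 1))

end Metric

end BiconservativeSurface

end

/-!
In a normal form `g = du² + f(u)^(-3/2) dv²` the Gaussian curvature is
`K = (3/4) f''/f - (21/16) (f'/f)²`, so the differential equation for `f` says exactly that
`1 + K + 3 f² + c² f³ = 0`. Hence `f` is the positive root attached to `K`, the level curves of `K`
are the lines `u = const`, and their geodesic curvature with respect to `-grad K / |grad K| = ∂/∂u`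
is `(3/4) f'/f`, which the formula for `grad K` turns into the asserted expression
(`IsNormalForm.circle_equations`, `IsNormalForm.levelCurvature_eq`).

Conversely, the positive root `x` of `1 + K + 3 x² + c² x³ = 0` is a smooth function without
critical points, and it can be completed to a positively oriented chart `(x, y)`
(`exists_isAdaptedChart`). The circle condition on the lines `x = const`, run through at unit speed,
gives two facts (`IsAdaptedChart.circle_consequences`): the norm `|dx|` depends on `x` only, and
`Γ⁰₁₁` has a prescribed value. With `b = g₀₁` and `H = g₁₁`, they say that the two one-forms
`dx / |dx|` and `x^(3/4) (√H dy + b/√H dx)` are closed. Their primitives `u` and `v` are coordinates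
in which the metric is `du² + x^(-3/2) dv²` with `x = f(u)`, and the differential equation for `f`
is read off from `K` (`hasNormalFormAt_of_hasCircularLevelCurves`).

For the statement with a constant depending on the point: `K`, `|grad K|` and the geodesic curvature
of the level curve through a point determine `f` and then `c²` at that point
(`IsNormalForm.sq_const_unique`), so `c²` is locally constant, hence constant on the connected
surface.

Since `K` and the covariant derivative are defined through preferred charts, all of this rests on
their independence of the chart. It is obtained from the gauge transformation law
`J ωᵢ = ∂ᵢJ + Aᵢ J` of the matrices `ωᵢ = (Γˡᵢₖ)` under a coordinate change with Jacobian matrix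
`J` (`IsPullback.jac_mul_connMat`, `IsPullback.jac_mul_curvMat`).
-/

noncomputable section

namespace BiconservativeSurface

open Matrix

/-! ### Calculus of plane functions and matrix fields -/

/-- The Jacobian matrix `(∂φᵃ/∂xⁱ)` of a plane map. -/
def jac (φ : Plane → Plane) (x : Plane) : Matrix (Fin 2) (Fin 2) ℝ :=
  Matrix.of fun a i => partialDeriv i (fun y => φ y a) x

/-- The entrywise partial derivative of a matrix field. -/
def pdMat (i : Fin 2) (A : Plane → Matrix (Fin 2) (Fin 2) ℝ) (x : Plane) :
    Matrix (Fin 2) (Fin 2) ℝ :=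
  Matrix.of fun a b => partialDeriv i (fun y => A y a b) x

/-- Entrywise differentiability of a matrix field at a point; no norm on matrices is singled out. -/
def MatDiffAt (A : Plane → Matrix (Fin 2) (Fin 2) ℝ) (x : Plane) : Prop :=
  ∀ a b, DifferentiableAt ℝ (fun y => A y a b) x

theorem partialDeriv_congr {h k : Plane → ℝ} {x : Plane} (i : Fin 2) (hk : h =ᶠ[nhds x] k) :
    partialDeriv i h x = partialDeriv i k x := by
  unfold partialDeriv; rw [hk.fderiv_eq]

theorem partialDeriv_add {h k : Plane → ℝ} {x : Plane} (i : Fin 2)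
    (hh : DifferentiableAt ℝ h x) (hk : DifferentiableAt ℝ k x) :
    partialDeriv i (fun y => h y + k y) x = partialDeriv i h x + partialDeriv i k x := by
  unfold partialDeriv; rw [fderiv_fun_add hh hk]; simp

theorem partialDeriv_mul {h k : Plane → ℝ} {x : Plane} (i : Fin 2)
    (hh : DifferentiableAt ℝ h x) (hk : DifferentiableAt ℝ k x) :
    partialDeriv i (fun y => h y * k y) x
      = partialDeriv i h x * k x + h x * partialDeriv i k x := by
  unfold partialDeriv; rw [fderiv_fun_mul hh hk]; simp; ring

theorem partialDeriv_const (i : Fin 2) (r : ℝ) (x : Plane) :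
    partialDeriv i (fun _ => r) x = 0 := by
  unfold partialDeriv; simp

/-- A continuous linear form on the plane is determined by its values on the basis vectors. -/
theorem clm_apply_eq_sum (L : Plane →L[ℝ] ℝ) (w : Plane) :
    L w = ∑ i, w i * L (EuclideanSpace.single i 1) := by
  have hw : w = ∑ i, w i • EuclideanSpace.single i (1 : ℝ) := by
    ext j; fin_cases j <;> simp
  conv_lhs => rw [hw]
  simp

theorem fderiv_eq_sum (h : Plane → ℝ) (x w : Plane) :
    fderiv ℝ h x w = ∑ i, w i * partialDeriv i h x :=
  clm_apply_eq_sum _ _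

theorem fderiv_coord {φ : Plane → Plane} {x : Plane} (hφ : DifferentiableAt ℝ φ x)
    (w : Plane) (a : Fin 2) : fderiv ℝ φ x w a = fderiv ℝ (fun y => φ y a) x w := by
  have := (hasFDerivWithinAt_univ.1 (hasFDerivWithinAt_euclidean.1 hφ.hasFDerivAt.hasFDerivWithinAt a)).fderiv
  rw [this]; rfl

theorem fderiv_apply_eq_jac {φ : Plane → Plane} {x : Plane} (hφ : DifferentiableAt ℝ φ x)
    (w : Plane) (a : Fin 2) : fderiv ℝ φ x w a = ∑ i, jac φ x a i * w i := by
  rw [fderiv_coord hφ, fderiv_eq_sum]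
  simp [jac, mul_comm]

theorem fderiv_single {φ : Plane → Plane} {x : Plane} (hφ : DifferentiableAt ℝ φ x)
    (i a : Fin 2) : fderiv ℝ φ x (EuclideanSpace.single i 1) a = jac φ x a i := by
  rw [fderiv_coord hφ]; rfl

theorem det_clm_eq (L : Plane →L[ℝ] Plane) :
    L.det = L (EuclideanSpace.single 0 1) 0 * L (EuclideanSpace.single 1 1) 1
      - L (EuclideanSpace.single 1 1) 0 * L (EuclideanSpace.single 0 1) 1 := by
  rw [ContinuousLinearMap.det,
    ← LinearMap.det_toMatrix (EuclideanSpace.basisFun (Fin 2) ℝ).toBasis, Matrix.det_fin_two]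
  simp [LinearMap.toMatrix_apply]

theorem det_fderiv_eq_jac {φ : Plane → Plane} {x : Plane} (hφ : DifferentiableAt ℝ φ x) :
    (fderiv ℝ φ x).det = (jac φ x).det := by
  rw [det_clm_eq, Matrix.det_fin_two]
  simp [fderiv_single hφ]

theorem differentiableAt_coord {φ : Plane → Plane} {x : Plane} (hφ : DifferentiableAt ℝ φ x)
    (a : Fin 2) : DifferentiableAt ℝ (fun y => φ y a) x :=
  differentiableAt_euclidean.1 hφ a

theorem partialDeriv_comp {h : Plane → ℝ} {φ : Plane → Plane} {x : Plane} (i : Fin 2)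
    (hh : DifferentiableAt ℝ h (φ x)) (hφ : DifferentiableAt ℝ φ x) :
    partialDeriv i (fun y => h (φ y)) x = ∑ b, jac φ x b i * partialDeriv b h (φ x) := by
  have : fderiv ℝ (fun y => h (φ y)) x = (fderiv ℝ h (φ x)).comp (fderiv ℝ φ x) :=
    fderiv_comp x hh hφ
  rw [partialDeriv, this, ContinuousLinearMap.comp_apply, fderiv_eq_sum]
  simp [fderiv_single hφ]

theorem jac_comp {ψ φ : Plane → Plane} {x : Plane}
    (hψ : DifferentiableAt ℝ ψ (φ x)) (hφ : DifferentiableAt ℝ φ x) :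
    jac (fun y => ψ (φ y)) x = jac ψ (φ x) * jac φ x := by
  ext a i
  simp only [jac, Matrix.of_apply, Matrix.mul_apply]
  rw [partialDeriv_comp i (differentiableAt_coord hψ a) hφ]
  simp [jac, mul_comm]

theorem contDiffOn_partialDeriv {h : Plane → ℝ} {U : Set Plane} (hU : IsOpen U)
    (hh : ContDiffOn ℝ ∞ h U) (i : Fin 2) :
    ContDiffOn ℝ ∞ (BiconservativeSurface.partialDeriv i h) U :=
  (hh.fderiv_of_isOpen hU (m := ∞) (by simp)).clm_apply contDiffOn_const

theorem partialDeriv_comm {h : Plane → ℝ} {U : Set Plane} (hU : IsOpen U)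
    (hh : ContDiffOn ℝ ∞ h U) {x : Plane} (hx : x ∈ U) (i j : Fin 2) :
    partialDeriv i (partialDeriv j h) x = partialDeriv j (partialDeriv i h) x := by
  have hat : ContDiffAt ℝ ∞ h x := hh.contDiffAt (hU.mem_nhds hx)
  have hs : IsSymmSndFDerivAt ℝ h x := hat.isSymmSndFDerivAt (by
    simp only [minSmoothness_of_isRCLikeNormedField]
    exact WithTop.coe_le_coe.2 le_top)
  have hd : DifferentiableAt ℝ (fderiv ℝ h) x :=
    ((hh.fderiv_of_isOpen hU (m := ∞) (by simp)).contDiffAt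
      (hU.mem_nhds hx)).differentiableAt (by simp)
  have key : ∀ i j : Fin 2, partialDeriv i (partialDeriv j h) x
      = fderiv ℝ (fderiv ℝ h) x (EuclideanSpace.single i 1) (EuclideanSpace.single j 1) := by
    intro i j
    unfold partialDeriv
    rw [fderiv_clm_apply hd (differentiableAt_const _)]
    simp
  rw [key, key]
  exact hs.eq _ _

theorem differentiableAt_of_contDiffOn {h : Plane → ℝ} {U : Set Plane} (hU : IsOpen U)
    (hh : ContDiffOn ℝ ∞ h U) {x : Plane} (hx : x ∈ U) : DifferentiableAt ℝ h x :=
  (hh.contDiffAt (hU.mem_nhds hx)).differentiableAt (by simp)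

theorem pdMat_congr {A B : Plane → Matrix (Fin 2) (Fin 2) ℝ} {x : Plane} (i : Fin 2)
    (h : A =ᶠ[nhds x] B) : pdMat i A x = pdMat i B x := by
  ext a b
  exact partialDeriv_congr i (h.fun_comp (fun m => m a b))

theorem MatDiffAt.mul {A B : Plane → Matrix (Fin 2) (Fin 2) ℝ} {x : Plane}
    (hA : MatDiffAt A x) (hB : MatDiffAt B x) : MatDiffAt (fun y => A y * B y) x := by
  intro a b
  simp only [Matrix.mul_apply, Fin.sum_univ_two]
  exact ((hA a 0).mul (hB 0 b)).add ((hA a 1).mul (hB 1 b))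

theorem MatDiffAt.add {A B : Plane → Matrix (Fin 2) (Fin 2) ℝ} {x : Plane}
    (hA : MatDiffAt A x) (hB : MatDiffAt B x) : MatDiffAt (fun y => A y + B y) x :=
  fun a b => (hA a b).add (hB a b)

theorem MatDiffAt.transpose {A : Plane → Matrix (Fin 2) (Fin 2) ℝ} {x : Plane}
    (hA : MatDiffAt A x) : MatDiffAt (fun y => (A y)ᵀ) x :=
  fun a b => hA b a

theorem MatDiffAt.smul {h : Plane → ℝ} {A : Plane → Matrix (Fin 2) (Fin 2) ℝ} {x : Plane}
    (hh : DifferentiableAt ℝ h x) (hA : MatDiffAt A x) : MatDiffAt (fun y => h y • A y) x :=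
  fun a b => hh.mul (hA a b)

theorem pdMat_mul {A B : Plane → Matrix (Fin 2) (Fin 2) ℝ} {x : Plane} (i : Fin 2)
    (hA : MatDiffAt A x) (hB : MatDiffAt B x) :
    pdMat i (fun y => A y * B y) x = pdMat i A x * B x + A x * pdMat i B x := by
  ext a b
  simp only [pdMat, Matrix.of_apply, Matrix.mul_apply, Fin.sum_univ_two, Matrix.add_apply]
  rw [partialDeriv_add i ((hA a 0).fun_mul (hB 0 b)) ((hA a 1).fun_mul (hB 1 b)),
    partialDeriv_mul i (hA a 0) (hB 0 b), partialDeriv_mul i (hA a 1) (hB 1 b)]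
  ring

theorem pdMat_add {A B : Plane → Matrix (Fin 2) (Fin 2) ℝ} {x : Plane} (i : Fin 2)
    (hA : MatDiffAt A x) (hB : MatDiffAt B x) :
    pdMat i (fun y => A y + B y) x = pdMat i A x + pdMat i B x := by
  ext a b
  exact partialDeriv_add i (hA a b) (hB a b)

theorem pdMat_smul {h : Plane → ℝ} {A : Plane → Matrix (Fin 2) (Fin 2) ℝ} {x : Plane} (i : Fin 2)
    (hh : DifferentiableAt ℝ h x) (hA : MatDiffAt A x) :
    pdMat i (fun y => h y • A y) x = partialDeriv i h x • A x + h x • pdMat i A x := by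
  ext a b
  exact partialDeriv_mul i hh (hA a b)

theorem pdMat_transpose (A : Plane → Matrix (Fin 2) (Fin 2) ℝ) (x : Plane) (i : Fin 2) :
    pdMat i (fun y => (A y)ᵀ) x = (pdMat i A x)ᵀ := rfl

theorem pdMat_comp {A : Plane → Matrix (Fin 2) (Fin 2) ℝ} {φ : Plane → Plane} {x : Plane}
    (i : Fin 2) (hA : MatDiffAt A (φ x)) (hφ : DifferentiableAt ℝ φ x) :
    pdMat i (fun y => A (φ y)) x = ∑ b, jac φ x b i • pdMat b A (φ x) := by
  ext a b
  simp only [pdMat, Matrix.of_apply, Matrix.sum_apply, Matrix.smul_apply, smul_eq_mul]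
  exact partialDeriv_comp i (hA a b) hφ

theorem MatDiffAt.comp {A : Plane → Matrix (Fin 2) (Fin 2) ℝ} {φ : Plane → Plane} {x : Plane}
    (hA : MatDiffAt A (φ x)) (hφ : DifferentiableAt ℝ φ x) : MatDiffAt (fun y => A (φ y)) x :=
  fun a b => DifferentiableAt.comp x (hA a b) hφ

/-! ### Christoffel symbols and curvature under a change of coordinates -/

/-- `G` is a smooth Riemannian metric on the open set `U` of the plane. Positive definiteness is
recorded as positivity of the diagonal entries and of the determinant. -/
structure SmoothMetricOn (G : Plane → Matrix (Fin 2) (Fin 2) ℝ) (U : Set Plane) : Prop where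
  isOpen : IsOpen U
  smooth : ∀ a b, ContDiffOn ℝ ∞ (fun x => G x a b) U
  symm : ∀ x ∈ U, (G x)ᵀ = G x
  pos : ∀ x ∈ U, 0 < G x 0 0 ∧ 0 < G x 1 1
  det_pos : ∀ x ∈ U, 0 < (G x).det

/-- The connection matrix `(Γˡᵢₖ)` with row index `l` and column index `k`. -/
def connMat (G : Plane → Matrix (Fin 2) (Fin 2) ℝ) (i : Fin 2) (x : Plane) :
    Matrix (Fin 2) (Fin 2) ℝ :=
  Matrix.of fun l k => christoffel G l i k x

/-- The Christoffel symbols of the first kind, `Γ_{l,ik}`, with row index `l`. -/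
def firstKind (G : Plane → Matrix (Fin 2) (Fin 2) ℝ) (i : Fin 2) (x : Plane) :
    Matrix (Fin 2) (Fin 2) ℝ :=
  Matrix.of fun l k => (1 / 2) * (partialDeriv i (fun y => G y k l) x
    + partialDeriv k (fun y => G y i l) x - partialDeriv l (fun y => G y i k) x)

/-- The curvature matrix `R(∂₀, ∂₁)`. -/
def curvMat (G : Plane → Matrix (Fin 2) (Fin 2) ℝ) (x : Plane) : Matrix (Fin 2) (Fin 2) ℝ :=
  pdMat 0 (connMat G 1) x - pdMat 1 (connMat G 0) x
    + (connMat G 0 x * connMat G 1 x - connMat G 1 x * connMat G 0 x)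

theorem connMat_eq (G : Plane → Matrix (Fin 2) (Fin 2) ℝ) (i : Fin 2) (x : Plane) :
    connMat G i x = (G x)⁻¹ * firstKind G i x := by
  ext l k
  simp only [connMat, firstKind, christoffel, Matrix.of_apply, Matrix.mul_apply, Finset.mul_sum]
  exact Finset.sum_congr rfl fun j _ => by ring

theorem curvatureOfCoeff_eq (G : Plane → Matrix (Fin 2) (Fin 2) ℝ) (x : Plane) :
    curvatureOfCoeff G x = ((G x)ᵀ * curvMat G x) 0 1 / (G x).det := by
  have : ∀ l, riemannCoeff G l 1 0 1 x = curvMat G x l 1 := by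
    intro l
    simp [riemannCoeff, curvMat, pdMat, connMat, Matrix.mul_apply, Fin.sum_univ_two]
  simp [curvatureOfCoeff, this, Matrix.mul_apply]

variable {G G' : Plane → Matrix (Fin 2) (Fin 2) ℝ} {U U' : Set Plane}

theorem SmoothMetricOn.isUnit (hG : SmoothMetricOn G U) {x : Plane} (hx : x ∈ U) :
    IsUnit (G x).det := (hG.det_pos x hx).ne'.isUnit

theorem SmoothMetricOn.metric_mul_connMat (hG : SmoothMetricOn G U) {x : Plane} (hx : x ∈ U)
    (i : Fin 2) : G x * connMat G i x = firstKind G i x := by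
  rw [connMat_eq, Matrix.mul_nonsing_inv_cancel_left _ _ (hG.isUnit hx)]

theorem SmoothMetricOn.matDiffAt (hG : SmoothMetricOn G U) {x : Plane} (hx : x ∈ U) :
    MatDiffAt G x := fun a b => differentiableAt_of_contDiffOn hG.isOpen (hG.smooth a b) hx

theorem SmoothMetricOn.contDiffOn_inv (hG : SmoothMetricOn G U) (a b : Fin 2) :
    ContDiffOn ℝ ∞ (fun x => (G x)⁻¹ a b) U := by
  have hdet : ContDiffOn ℝ ∞ (fun x => (G x 0 0 * G x 1 1 - G x 0 1 * G x 1 0)⁻¹) U := by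
    refine ContDiffOn.inv (((hG.smooth 0 0).mul (hG.smooth 1 1)).sub
      ((hG.smooth 0 1).mul (hG.smooth 1 0))) fun x hx => ?_
    rw [← Matrix.det_fin_two]
    exact (hG.det_pos x hx).ne'
  have e : ∀ x, (G x)⁻¹ = (G x 0 0 * G x 1 1 - G x 0 1 * G x 1 0)⁻¹ •
      !![G x 1 1, -G x 0 1; -G x 1 0, G x 0 0] := by
    intro x
    rw [Matrix.inv_def, Matrix.adjugate_fin_two, Ring.inverse_eq_inv', Matrix.det_fin_two]
  simp only [e]
  fin_cases a <;> fin_cases b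
  exacts [hdet.mul (hG.smooth 1 1), hdet.mul (hG.smooth 0 1).neg,
    hdet.mul (hG.smooth 1 0).neg, hdet.mul (hG.smooth 0 0)]

theorem SmoothMetricOn.contDiffOn_christoffel (hG : SmoothMetricOn G U) (k i j : Fin 2) :
    ContDiffOn ℝ ∞ (christoffel G k i j) U := by
  unfold christoffel
  refine contDiffOn_const.mul (ContDiffOn.sum fun l _ => (hG.contDiffOn_inv k l).mul ?_)
  exact ((contDiffOn_partialDeriv hG.isOpen (hG.smooth _ _) _).add
    (contDiffOn_partialDeriv hG.isOpen (hG.smooth _ _) _)).sub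
    (contDiffOn_partialDeriv hG.isOpen (hG.smooth _ _) _)

theorem SmoothMetricOn.matDiffAt_connMat (hG : SmoothMetricOn G U) {x : Plane} (hx : x ∈ U)
    (i : Fin 2) : MatDiffAt (connMat G i) x :=
  fun a b => differentiableAt_of_contDiffOn hG.isOpen (hG.contDiffOn_christoffel a i b) hx

theorem SmoothMetricOn.contDiffOn_curvature (hG : SmoothMetricOn G U) :
    ContDiffOn ℝ ∞ (curvatureOfCoeff G) U := by
  unfold curvatureOfCoeff
  refine ContDiffOn.div (ContDiffOn.sum fun l _ => (hG.smooth l 0).mul ?_) ?_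
    fun x hx => (hG.det_pos x hx).ne'
  · unfold riemannCoeff
    refine ((contDiffOn_partialDeriv hG.isOpen (hG.contDiffOn_christoffel _ _ _) _).sub
      (contDiffOn_partialDeriv hG.isOpen (hG.contDiffOn_christoffel _ _ _) _)).add
      (ContDiffOn.sum fun m _ => ?_)
    exact ((hG.contDiffOn_christoffel _ _ _).mul (hG.contDiffOn_christoffel _ _ _)).sub
      ((hG.contDiffOn_christoffel _ _ _).mul (hG.contDiffOn_christoffel _ _ _))
  · simp only [Matrix.det_fin_two]
    exact ((hG.smooth 0 0).mul (hG.smooth 1 1)).sub ((hG.smooth 0 1).mul (hG.smooth 1 0))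

/-- Metric compatibility of the Levi-Civita connection. -/
theorem SmoothMetricOn.pdMat_metric (hG : SmoothMetricOn G U) {x : Plane} (hx : x ∈ U)
    (i : Fin 2) : pdMat i G x = G x * connMat G i x + (connMat G i x)ᵀ * G x := by
  have h1 := hG.metric_mul_connMat hx i
  have h2 : (connMat G i x)ᵀ * G x = (firstKind G i x)ᵀ := by
    rw [← h1, Matrix.transpose_mul, hG.symm x hx]
  have hs : ∀ a b, partialDeriv i (fun y => G y a b) x = partialDeriv i (fun y => G y b a) x := by
    intro a b
    apply partialDeriv_congr
    filter_upwards [hG.isOpen.mem_nhds hx] with y hy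
    exact congrFun (congrFun (hG.symm y hy) b) a
  rw [h1, h2]
  ext a b
  simp only [pdMat, firstKind, Matrix.of_apply, Matrix.add_apply, Matrix.transpose_apply]
  rw [hs b a]; ring

/-- The curvature operator is skew-symmetric with respect to the metric. -/
theorem SmoothMetricOn.curvMat_skew (hG : SmoothMetricOn G U) {x : Plane} (hx : x ∈ U) :
    G x * curvMat G x + (G x * curvMat G x)ᵀ = 0 := by
  have hGd := hG.matDiffAt hx
  have hw := hG.matDiffAt_connMat hx
  have hev : ∀ i, pdMat i G =ᶠ[nhds x]
      fun y => G y * connMat G i y + (connMat G i y)ᵀ * G y := by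
    intro i
    filter_upwards [hG.isOpen.mem_nhds hx] with y hy using hG.pdMat_metric hy i
  have hcomm : pdMat 0 (pdMat 1 G) x = pdMat 1 (pdMat 0 G) x := by
    ext a b
    exact partialDeriv_comm hG.isOpen (hG.smooth a b) hx 0 1
  rw [pdMat_congr 0 (hev 1), pdMat_congr 1 (hev 0),
    pdMat_add 0 (hGd.mul (hw 1)) ((hw 1).transpose.mul hGd),
    pdMat_add 1 (hGd.mul (hw 0)) ((hw 0).transpose.mul hGd),
    pdMat_mul 0 hGd (hw 1), pdMat_mul 1 hGd (hw 0),
    pdMat_mul 0 (hw 1).transpose hGd, pdMat_mul 1 (hw 0).transpose hGd,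
    pdMat_transpose, pdMat_transpose, hG.pdMat_metric hx, hG.pdMat_metric hx] at hcomm
  rw [Matrix.transpose_mul, hG.symm x hx, curvMat]
  simp only [Matrix.transpose_add, Matrix.transpose_sub, Matrix.transpose_mul]
  rw [← sub_eq_zero] at hcomm
  rw [← hcomm]
  noncomm_ring

/-- The hypotheses under which `G` is the pull-back of the metric `G'` by the coordinate change
`φ`. -/
structure IsPullback (G G' : Plane → Matrix (Fin 2) (Fin 2) ℝ) (φ : Plane → Plane)
    (U U' : Set Plane) : Prop where
  left : SmoothMetricOn G U
  right : SmoothMetricOn G' U'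
  smooth : ContDiffOn ℝ ∞ φ U
  mapsTo : MapsTo φ U U'
  eq : ∀ x ∈ U, G x = (jac φ x)ᵀ * G' (φ x) * jac φ x

namespace IsPullback

variable {φ : Plane → Plane}

theorem diffAt (h : IsPullback G G' φ U U') {x : Plane} (hx : x ∈ U) :
    DifferentiableAt ℝ φ x :=
  (h.smooth.contDiffAt (h.left.isOpen.mem_nhds hx)).differentiableAt (by simp)

theorem smooth_coord (h : IsPullback G G' φ U U') (a : Fin 2) :
    ContDiffOn ℝ ∞ (fun y => φ y a) U := contDiffOn_euclidean.1 h.smooth a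

theorem jac_matDiffAt (h : IsPullback G G' φ U U') {x : Plane} (hx : x ∈ U) :
    MatDiffAt (jac φ) x := fun a b =>
  differentiableAt_of_contDiffOn h.left.isOpen (contDiffOn_partialDeriv h.left.isOpen (h.smooth_coord a) b) hx

theorem pdMat_jac_symm (h : IsPullback G G' φ U U') {x : Plane} (hx : x ∈ U) (a i j : Fin 2) :
    pdMat i (jac φ) x a j = pdMat j (jac φ) x a i :=
  partialDeriv_comm h.left.isOpen (h.smooth_coord a) hx i j

theorem isUnit_jac (h : IsPullback G G' φ U U') {x : Plane} (hx : x ∈ U) :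
    IsUnit (jac φ x).det := by
  have h1 := h.left.det_pos x hx
  rw [h.eq x hx, Matrix.det_mul, Matrix.det_mul] at h1
  refine isUnit_iff_ne_zero.2 fun h0 => ?_
  simp [h0] at h1

/-- The transformation law `Γ_{l,ik} = ∑ Jᵃ_l G'_{ab} ∂ᵢJᵇ_k + ∑ Γ'_{a,bc} Jᵃ_l Jᵇ_i Jᶜ_k` of the
Christoffel symbols of the first kind. -/
theorem firstKind_eq (h : IsPullback G G' φ U U') {x : Plane} (hx : x ∈ U) (i : Fin 2) :
    firstKind G i x = (jac φ x)ᵀ * G' (φ x) * pdMat i (jac φ) x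
      + (jac φ x)ᵀ * (∑ b, jac φ x b i • firstKind G' b (φ x)) * jac φ x := by
  have hJ := h.jac_matDiffAt hx
  have hx' := h.mapsTo hx
  have hG'd := h.right.matDiffAt hx'
  have hφ := h.diffAt hx
  have hpd : ∀ m, pdMat m G x = (pdMat m (jac φ) x)ᵀ * G' (φ x) * jac φ x
      + (jac φ x)ᵀ * (∑ c, jac φ x c m • pdMat c G' (φ x)) * jac φ x
      + (jac φ x)ᵀ * G' (φ x) * pdMat m (jac φ) x := by
    intro m
    have hev : G =ᶠ[nhds x] fun y => (jac φ y)ᵀ * G' (φ y) * jac φ y := by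
      filter_upwards [h.left.isOpen.mem_nhds hx] with y hy using h.eq y hy
    have hc : MatDiffAt (fun y => G' (φ y)) x := hG'd.comp hφ
    rw [pdMat_congr m hev, pdMat_mul m (hJ.transpose.mul hc) hJ,
      pdMat_mul m hJ.transpose hc, pdMat_comp m hG'd hφ, pdMat_transpose]
    noncomm_ring
  have hE : ∀ m a b, partialDeriv m (fun y => G y a b) x = pdMat m G x a b := fun _ _ _ => rfl
  have hE' : ∀ m a b, partialDeriv m (fun y => G' y a b) (φ x) = pdMat m G' (φ x) a b :=
    fun _ _ _ => rfl
  have hs : G' (φ x) 1 0 = G' (φ x) 0 1 :=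
    (congrFun (congrFun (h.right.symm _ hx') 0) 1)
  have hs' : ∀ m, pdMat m G' (φ x) 1 0 = pdMat m G' (φ x) 0 1 := by
    intro m
    apply partialDeriv_congr
    filter_upwards [h.right.isOpen.mem_nhds hx'] with y hy
    exact congrFun (congrFun (h.right.symm y hy) 0) 1
  have hjs : ∀ a, pdMat 1 (jac φ) x a 0 = pdMat 0 (jac φ) x a 1 :=
    fun a => h.pdMat_jac_symm hx a 1 0
  ext l k
  fin_cases i <;> fin_cases l <;> fin_cases k <;>
  · simp only [firstKind, hE, hpd, hE', Matrix.of_apply, Matrix.mul_apply, Matrix.add_apply,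
      Matrix.transpose_apply, Fin.sum_univ_two, Matrix.smul_apply, smul_eq_mul, Fin.mk_one,
      Fin.zero_eta, Fin.isValue, hs, hs', hjs, one_div]
    ring

/-- The gauge transformation law `J ωᵢ = ∂ᵢJ + Aᵢ J` of the connection matrices, where
`Aᵢ = ∑ Jᵇ_i ω'_b` is the pull-back of the connection. -/
theorem jac_mul_connMat (h : IsPullback G G' φ U U') {x : Plane} (hx : x ∈ U) (i : Fin 2) :
    jac φ x * connMat G i x = pdMat i (jac φ) x
      + (∑ b, jac φ x b i • connMat G' b (φ x)) * jac φ x := by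
  have hx' := h.mapsTo hx
  have hJ := h.isUnit_jac hx
  have hu : IsUnit ((jac φ x)ᵀ * G' (φ x)).det := by
    rw [Matrix.det_mul, Matrix.det_transpose]
    exact hJ.mul (h.right.isUnit hx')
  have key : ((jac φ x)ᵀ * G' (φ x)) * (jac φ x * connMat G i x)
      = ((jac φ x)ᵀ * G' (φ x)) * (pdMat i (jac φ) x
        + (∑ b, jac φ x b i • connMat G' b (φ x)) * jac φ x) := by
    have h1 := h.left.metric_mul_connMat hx i
    rw [h.firstKind_eq hx i, h.eq x hx] at h1
    rw [← Matrix.mul_assoc, h1, Matrix.mul_add]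
    simp only [Fin.sum_univ_two, ← h.right.metric_mul_connMat hx']
    simp only [Matrix.mul_assoc, Matrix.mul_add, Matrix.add_mul, Matrix.smul_mul, Matrix.mul_smul]
  have := congrArg (fun m => ((jac φ x)ᵀ * G' (φ x))⁻¹ * m) key
  simpa only [Matrix.nonsing_inv_mul_cancel_left _ _ hu] using this

/-- The transformation law `J R = (det J) R' J` of the curvature matrix. -/
theorem jac_mul_curvMat (h : IsPullback G G' φ U U') {x : Plane} (hx : x ∈ U) :
    jac φ x * curvMat G x = (jac φ x).det • (curvMat G' (φ x) * jac φ x) := by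
  have hx' := h.mapsTo hx
  have hφ := h.diffAt hx
  have hJ := h.jac_matDiffAt hx
  have hw := h.left.matDiffAt_connMat hx
  have hw' := h.right.matDiffAt_connMat hx'
  set A : Fin 2 → Plane → Matrix (Fin 2) (Fin 2) ℝ :=
    fun i y => jac φ y 0 i • connMat G' 0 (φ y) + jac φ y 1 i • connMat G' 1 (φ y) with hA
  have hlaw : ∀ y ∈ U, ∀ i, jac φ y * connMat G i y = pdMat i (jac φ) y + A i y * jac φ y := by
    intro y hy i
    rw [h.jac_mul_connMat hy i, Fin.sum_univ_two]
  have hAd : ∀ i, MatDiffAt (A i) x := fun i =>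
    (MatDiffAt.smul (hJ 0 i) ((hw' 0).comp hφ)).add (MatDiffAt.smul (hJ 1 i) ((hw' 1).comp hφ))
  have hJ2 : ∀ i, MatDiffAt (pdMat i (jac φ)) x := fun i a b =>
    differentiableAt_of_contDiffOn h.left.isOpen (contDiffOn_partialDeriv h.left.isOpen
      (contDiffOn_partialDeriv h.left.isOpen (h.smooth_coord a) b) i) hx
  have hd : ∀ i j, pdMat j (jac φ) x * connMat G i x + jac φ x * pdMat j (connMat G i) x
      = pdMat j (pdMat i (jac φ)) x
        + (pdMat j (A i) x * jac φ x + A i x * pdMat j (jac φ) x) := by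
    intro i j
    have hev : (fun y => jac φ y * connMat G i y) =ᶠ[nhds x]
        fun y => pdMat i (jac φ) y + A i y * jac φ y := by
      filter_upwards [h.left.isOpen.mem_nhds hx] with y hy using hlaw y hy i
    have := pdMat_congr j hev
    rwa [pdMat_mul j hJ (hw i), pdMat_add j (hJ2 i) ((hAd i).mul hJ),
      pdMat_mul j (hAd i) hJ] at this
  have hcomm : pdMat 0 (pdMat 1 (jac φ)) x = pdMat 1 (pdMat 0 (jac φ)) x := by
    ext a b
    exact partialDeriv_comm h.left.isOpen
      (contDiffOn_partialDeriv h.left.isOpen (h.smooth_coord a) b) hx 0 1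
  have hjac : ∀ i, pdMat i (jac φ) x = jac φ x * connMat G i x - A i x * jac φ x := by
    intro i; rw [hlaw x hx i]; abel
  -- The curvature of the pulled-back connection `A`.
  have hF : pdMat 0 (A 1) x - pdMat 1 (A 0) x + (A 0 x * A 1 x - A 1 x * A 0 x)
      = (jac φ x).det • curvMat G' (φ x) := by
    have hp : ∀ i j, pdMat j (A i) x = pdMat j (jac φ) x 0 i • connMat G' 0 (φ x)
        + jac φ x 0 i • (∑ c, jac φ x c j • pdMat c (connMat G' 0) (φ x))
        + (pdMat j (jac φ) x 1 i • connMat G' 1 (φ x)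
        + jac φ x 1 i • (∑ c, jac φ x c j • pdMat c (connMat G' 1) (φ x))) := by
      intro i j
      rw [hA, pdMat_add j (MatDiffAt.smul (hJ 0 i) ((hw' 0).comp hφ))
        (MatDiffAt.smul (hJ 1 i) ((hw' 1).comp hφ)),
        pdMat_smul j (hJ 0 i) ((hw' 0).comp hφ), pdMat_smul j (hJ 1 i) ((hw' 1).comp hφ),
        pdMat_comp j (hw' 0) hφ, pdMat_comp j (hw' 1) hφ]
      rfl
    rw [hp, hp, curvMat, Matrix.det_fin_two, h.pdMat_jac_symm hx 0 0 1, h.pdMat_jac_symm hx 1 0 1]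
    simp only [hA, Fin.sum_univ_two]
    ext a b
    simp only [Matrix.add_apply, Matrix.sub_apply, Matrix.smul_apply, Matrix.mul_apply,
      Fin.sum_univ_two, smul_eq_mul]
    ring
  have h10 := hd 1 0
  have h01 := hd 0 1
  have e1 : jac φ x * curvMat G x
      = (pdMat 0 (A 1) x - pdMat 1 (A 0) x + (A 0 x * A 1 x - A 1 x * A 0 x)) * jac φ x := by
    rw [← sub_eq_zero] at h10 h01 ⊢
    have : jac φ x * pdMat 0 (connMat G 1) x - jac φ x * pdMat 1 (connMat G 0) x
        = pdMat 0 (A 1) x * jac φ x + A 1 x * pdMat 0 (jac φ) x - pdMat 0 (jac φ) x * connMat G 1 x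
          - (pdMat 1 (A 0) x * jac φ x + A 0 x * pdMat 1 (jac φ) x
            - pdMat 1 (jac φ) x * connMat G 0 x) := by
      rw [hcomm] at h10
      rw [← sub_eq_zero]
      trans (0 - 0 : Matrix (Fin 2) (Fin 2) ℝ)
      · nth_rewrite 1 [← h10]; rw [← h01]; abel
      · simp
    rw [curvMat, Matrix.mul_add, Matrix.mul_sub, this, hjac 0, hjac 1]
    noncomm_ring
  rw [e1, hF, Matrix.smul_mul]

/-- The Gaussian curvature does not depend on the coordinates. -/
theorem curvatureOfCoeff_eq (h : IsPullback G G' φ U U') {x : Plane} (hx : x ∈ U) :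
    curvatureOfCoeff G x = curvatureOfCoeff G' (φ x) := by
  have hx' := h.mapsTo hx
  have hJ := (h.isUnit_jac hx).ne_zero
  rw [BiconservativeSurface.curvatureOfCoeff_eq, BiconservativeSurface.curvatureOfCoeff_eq,
    h.left.symm x hx, h.right.symm _ hx']
  have hS := h.right.curvMat_skew hx'
  have h1 : G x * curvMat G x
      = (jac φ x).det • ((jac φ x)ᵀ * (G' (φ x) * curvMat G' (φ x)) * jac φ x) := by
    rw [h.eq x hx, Matrix.mul_assoc, h.jac_mul_curvMat hx, Matrix.mul_smul]
    simp only [Matrix.mul_assoc]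
  have h2 : (G x).det = (jac φ x).det * (G' (φ x)).det * (jac φ x).det := by
    rw [h.eq x hx, Matrix.det_mul, Matrix.det_mul, Matrix.det_transpose]
  rw [h1, h2]
  set S := G' (φ x) * curvMat G' (φ x)
  have s00 : S 0 0 = 0 := by
    have := congrFun (congrFun hS 0) 0; simp at this; linarith
  have s11 : S 1 1 = 0 := by
    have := congrFun (congrFun hS 1) 1; simp at this; linarith
  have s10 : S 1 0 = -S 0 1 := by
    have := congrFun (congrFun hS 1) 0; simp at this; linarith
  have h3 : ((jac φ x)ᵀ * S * jac φ x) 0 1 = (jac φ x).det * S 0 1 := by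
    simp only [Matrix.mul_apply, Fin.sum_univ_two, Matrix.transpose_apply, s00, s11, s10,
      Matrix.det_fin_two]
    ring
  have hd := (h.right.det_pos _ hx').ne'
  rw [Matrix.smul_apply, h3, smul_eq_mul]
  field_simp

end IsPullback

/-! ### Charts, tangent vectors and the metric in coordinates -/

section Charts

variable {M : Type*} [TopologicalSpace M] {e e' : OpenPartialHomeomorph M Plane}

/-- The coordinate change from the chart `e` to the chart `e'`. -/
def transition (e e' : OpenPartialHomeomorph M Plane) : Plane → Plane := fun x => e' (e.symm x)

theorem mem_overlap {p : M} (hp : p ∈ e.source)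
    (hp' : p ∈ e'.source) : e p ∈ (e.symm ≫ₕ e').source := by
  simp [hp, hp']

theorem transition_apply {p : M} (hp : p ∈ e.source) :
    transition e e' (e p) = e' p := by simp [transition, hp]

variable [ChartedSpace Plane M]

theorem chart_mdifferentiable (he : e ∈ IsManifold.maximalAtlas (𝓡 2) ∞ M) :
    e.MDifferentiable (𝓡 2) (𝓡 2) :=
  ⟨(contMDiffOn_of_mem_maximalAtlas he).mdifferentiableOn (by simp),
    (contMDiffOn_symm_of_mem_maximalAtlas he).mdifferentiableOn (by simp)⟩

theorem transition_contDiffOn (he : e ∈ IsManifold.maximalAtlas (𝓡 2) ∞ M)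
    (he' : e' ∈ IsManifold.maximalAtlas (𝓡 2) ∞ M) :
    ContDiffOn ℝ ∞ (transition e e') (e.symm ≫ₕ e').source := by
  rw [← contMDiffOn_iff_contDiffOn]
  have h1 := contMDiffOn_of_mem_maximalAtlas he'
  have h2 := contMDiffOn_symm_of_mem_maximalAtlas he
  refine h1.comp (h2.mono ?_) ?_
  · exact fun x hx => hx.1
  · exact fun x hx => hx.2

theorem vecCoord_smul (e : OpenPartialHomeomorph M Plane) (p : M) (r : ℝ)
    (w : TangentSpace (𝓡 2) p) : vecCoord e p (r • w) = r • vecCoord e p w :=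
  map_smul (mfderiv (𝓡 2) (𝓡 2) e p) r w

theorem transition_diffAt (he : e ∈ IsManifold.maximalAtlas (𝓡 2) ∞ M)
    (he' : e' ∈ IsManifold.maximalAtlas (𝓡 2) ∞ M) {x : Plane}
    (hx : x ∈ (e.symm ≫ₕ e').source) : DifferentiableAt ℝ (transition e e') x :=
  ((transition_contDiffOn he he').contDiffAt
    ((e.symm ≫ₕ e').open_source.mem_nhds hx)).differentiableAt (by simp)

theorem vecCoord_transition (he : e ∈ IsManifold.maximalAtlas (𝓡 2) ∞ M)
    (he' : e' ∈ IsManifold.maximalAtlas (𝓡 2) ∞ M) {p : M} (hp : p ∈ e.source)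
    (hp' : p ∈ e'.source) (w : TangentSpace (𝓡 2) p) (a : Fin 2) :
    vecCoord e' p w a = ∑ i, jac (transition e e') (e p) a i * vecCoord e p w i := by
  have hd := transition_diffAt he he' (mem_overlap hp hp')
  have hev : e' =ᶠ[nhds p] (transition e e') ∘ e := by
    filter_upwards [e.open_source.mem_nhds hp] with q hq
    simp [transition, hq]
  have h1 : mfderiv (𝓡 2) (𝓡 2) e' p w
      = fderiv ℝ (transition e e') (e p) (vecCoord e p w) := by
    rw [hev.mfderiv_eq, mfderiv_comp p hd.mdifferentiableAt
      ((chart_mdifferentiable he).mdifferentiableAt hp), mfderiv_eq_fderiv]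
    rfl
  rw [← fderiv_apply_eq_jac hd, ← h1]
  rfl

theorem vecCoord_symm (he : e ∈ IsManifold.maximalAtlas (𝓡 2) ∞ M) {x : Plane}
    (hx : x ∈ e.target) (v : Plane) :
    vecCoord e (e.symm x) (mfderiv (𝓡 2) (𝓡 2) e.symm x v) = v := by
  have := (chart_mdifferentiable he).comp_symm_deriv hx
  exact DFunLike.congr_fun this v

theorem vecCoord_injective (he : e ∈ IsManifold.maximalAtlas (𝓡 2) ∞ M) {p : M}
    (hp : p ∈ e.source) : Function.Injective (vecCoord e p) :=
  (chart_mdifferentiable he).mfderiv_injective hp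

theorem symm_vecCoord (he : e ∈ IsManifold.maximalAtlas (𝓡 2) ∞ M) {x : Plane}
    (hx : x ∈ e.target) (w : TangentSpace (𝓡 2) (e.symm x)) :
    mfderiv (𝓡 2) (𝓡 2) e.symm x (vecCoord e (e.symm x) w) = w :=
  vecCoord_injective he (e.map_target hx) (vecCoord_symm he hx _)

/-- The coordinates of the velocity are the derivatives of the coordinates of the curve. -/
theorem vecCoord_velocity (he : e ∈ IsManifold.maximalAtlas (𝓡 2) ∞ M) {γ : ℝ → M} {t : ℝ}
    (ht : γ t ∈ e.source) (hγ : MDifferentiableAt 𝓘(ℝ, ℝ) (𝓡 2) γ t) (k : Fin 2) :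
    HasDerivAt (fun s => e (γ s) k) (vecCoord e (γ t) (velocity γ t) k) t := by
  have h1 := (chart_mdifferentiable he).mdifferentiableAt ht
  have h2 : MDifferentiableAt 𝓘(ℝ, ℝ) (𝓡 2) (fun s => e (γ s)) t := h1.comp t hγ
  have h3 : DifferentiableAt ℝ (fun s => e (γ s)) t := h2.differentiableAt
  have h4 : vecCoord e (γ t) (velocity γ t) = deriv (fun s => e (γ s)) t := by
    rw [← fderiv_apply_one_eq_deriv, ← mfderiv_eq_fderiv]
    have := mfderiv_comp_apply (I := 𝓘(ℝ, ℝ)) (I' := 𝓡 2) (I'' := 𝓡 2) t h1 hγ (1 : ℝ)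
    exact this.symm
  rw [h4]
  have := hasFDerivAt_iff_hasDerivAt.1 (hasFDerivWithinAt_univ.1
    (hasFDerivWithinAt_euclidean.1 h3.hasDerivAt.hasFDerivAt.hasFDerivWithinAt k))
  simpa using this

theorem mdifferentiableAt_curve {γ : ℝ → M} {a b t : ℝ}
    (hγ : ContMDiffOn 𝓘(ℝ, ℝ) (𝓡 2) ∞ γ (Ioo a b)) (ht : t ∈ Ioo a b) :
    MDifferentiableAt 𝓘(ℝ, ℝ) (𝓡 2) γ t :=
  ((hγ t ht).contMDiffAt (isOpen_Ioo.mem_nhds ht)).mdifferentiableAt (by simp)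

/-- The differential of a function in coordinates. -/
theorem mfderiv_eq_sum (he : e ∈ IsManifold.maximalAtlas (𝓡 2) ∞ M) {p : M}
    (hp : p ∈ e.source) {h : M → ℝ} (hh : DifferentiableAt ℝ (fun x => h (e.symm x)) (e p))
    (w : TangentSpace (𝓡 2) p) :
    mfderiv (𝓡 2) 𝓘(ℝ, ℝ) h p w
      = ∑ i, vecCoord e p w i * partialDeriv i (fun x => h (e.symm x)) (e p) := by
  have hev : h =ᶠ[nhds p] (fun x => h (e.symm x)) ∘ e := by
    filter_upwards [e.open_source.mem_nhds hp] with q hq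
    simp [hq]
  have h1 : mfderiv (𝓡 2) 𝓘(ℝ, ℝ) h p w
      = fderiv ℝ (fun x => h (e.symm x)) (e p) (vecCoord e p w) := by
    rw [hev.mfderiv_eq, mfderiv_comp p hh.mdifferentiableAt
      ((chart_mdifferentiable he).mdifferentiableAt hp), mfderiv_eq_fderiv]
    rfl
  rw [h1, fderiv_eq_sum]

variable [IsManifold (𝓡 2) ∞ M]

theorem isPositiveChart_chartAt (hM : IsOrientedAtlas M) (p : M) :
    IsPositiveChart (chartAt Plane p) :=
  ⟨IsManifold.chart_mem_maximalAtlas p, fun e' he' x hx =>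
    hM _ (chart_mem_atlas Plane p) e' he' x hx⟩

/-- Orientation of a pair of vectors can be tested in any positively oriented chart. -/
theorem isPositivePair_iff (he : IsPositiveChart e) {p : M} (hp : p ∈ e.source)
    (w z : TangentSpace (𝓡 2) p) : IsPositivePair p w z ↔
      0 < vecCoord e p w 0 * vecCoord e p z 1 - vecCoord e p w 1 * vecCoord e p z 0 := by
  have h0 := IsManifold.chart_mem_maximalAtlas (I := 𝓡 2) (n := ∞) p
  have hp0 := mem_chart_source Plane p
  have hdet := he.2 _ (chart_mem_atlas Plane p) _ (mem_overlap hp hp0)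
  have hd := transition_diffAt he.1 h0 (mem_overlap hp hp0)
  have : fderiv ℝ (e.symm ≫ₕ chartAt Plane p) (e p)
    = fderiv ℝ (transition e (chartAt Plane p)) (e p) := rfl
  rw [this, det_fderiv_eq_jac hd, Matrix.det_fin_two] at hdet
  unfold IsPositivePair
  simp only [vecCoord_transition he.1 h0 hp hp0, Fin.sum_univ_two]
  set J := jac (transition e (chartAt Plane p)) (e p)
  set a := vecCoord e p w
  set b := vecCoord e p z
  have : (J 0 0 * a 0 + J 0 1 * a 1) * (J 1 0 * b 0 + J 1 1 * b 1)
      - (J 1 0 * a 0 + J 1 1 * a 1) * (J 0 0 * b 0 + J 0 1 * b 1)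
      = (J 0 0 * J 1 1 - J 0 1 * J 1 0) * (a 0 * b 1 - a 1 * b 0) := by ring
  rw [this, mul_pos_iff_of_pos_left hdet]

end Charts

section Metric

variable {M : Type*} [TopologicalSpace M] [ChartedSpace Plane M] [IsManifold (𝓡 2) ∞ M]
  {e e' : OpenPartialHomeomorph M Plane} (g : SurfaceMetric M)

theorem inner_symm_eq (e : OpenPartialHomeomorph M Plane) (x v w : Plane) :
    g.inner (e.symm x) (mfderiv (𝓡 2) (𝓡 2) e.symm x v) (mfderiv (𝓡 2) (𝓡 2) e.symm x w)
      = ∑ i, ∑ j, metricCoeff g e x i j * v i * w j := by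
  have hv : ∀ v : Plane, v = v 0 • EuclideanSpace.single 0 (1 : ℝ)
      + v 1 • EuclideanSpace.single 1 (1 : ℝ) := by
    intro v; ext j; fin_cases j <;> simp
  let L : Plane →L[ℝ] TangentSpace (𝓡 2) (e.symm x) := mfderiv (𝓡 2) (𝓡 2) e.symm x
  let B := g.inner (e.symm x)
  have key : B (L v) (L w) = ∑ i, ∑ j,
      B (L (EuclideanSpace.single i 1)) (L (EuclideanSpace.single j 1)) * v i * w j := by
    conv_lhs => rw [hv v, hv w]
    simp only [map_add, map_smul, _root_.add_apply, _root_.smul_apply,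
      smul_eq_mul, Fin.sum_univ_two]
    ring
  exact key

/-- The metric in coordinates. -/
theorem inner_eq (he : e ∈ IsManifold.maximalAtlas (𝓡 2) ∞ M) {p : M} (hp : p ∈ e.source)
    (w z : TangentSpace (𝓡 2) p) : g.inner p w z
      = ∑ i, ∑ j, metricCoeff g e (e p) i j * vecCoord e p w i * vecCoord e p z j := by
  obtain ⟨x, hx, rfl⟩ : ∃ x ∈ e.target, e.symm x = p := ⟨e p, e.map_source hp, e.left_inv hp⟩
  rw [e.right_inv hx, ← inner_symm_eq, symm_vecCoord he hx, symm_vecCoord he hx]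

theorem metricCoeff_symm (e : OpenPartialHomeomorph M Plane) (x : Plane) :
    (metricCoeff g e x)ᵀ = metricCoeff g e x := by
  ext i j
  exact g.symm _ _ _

theorem metricCoeff_quadForm_pos (he : e ∈ IsManifold.maximalAtlas (𝓡 2) ∞ M) {x : Plane}
    (hx : x ∈ e.target) (v : Plane) (hv : v ≠ 0) :
    0 < ∑ i, ∑ j, metricCoeff g e x i j * v i * v j := by
  rw [← inner_symm_eq]
  refine g.pos _ _ fun h => hv ?_
  rw [← vecCoord_symm he hx v, h]
  exact map_zero (mfderiv (𝓡 2) (𝓡 2) e (e.symm x))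

theorem metricCoeff_pos (he : e ∈ IsManifold.maximalAtlas (𝓡 2) ∞ M) {x : Plane}
    (hx : x ∈ e.target) (i : Fin 2) : 0 < metricCoeff g e x i i := by
  have := metricCoeff_quadForm_pos g he hx (EuclideanSpace.single i 1) (by simp)
  fin_cases i <;> simpa using this

theorem metricCoeff_det_pos (he : e ∈ IsManifold.maximalAtlas (𝓡 2) ∞ M) {x : Plane}
    (hx : x ∈ e.target) : 0 < (metricCoeff g e x).det := by
  set m := metricCoeff g e x with hm
  have h0 : 0 < m 0 0 := metricCoeff_pos g he hx 0
  have hs : m 1 0 = m 0 1 := congrFun (congrFun (metricCoeff_symm g e x) 0) 1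
  -- On the vector `(-g₀₁, g₀₀)` the quadratic form takes the value `g₀₀ det g`.
  have h1 := metricCoeff_quadForm_pos g he hx (!₂[-m 0 1, m 0 0]) (by
    intro h
    have := congrArg (fun v : Plane => v 1) h
    simp at this
    exact h0.ne' this)
  rw [← hm] at h1
  simp only [Fin.sum_univ_two, hs] at h1
  simp at h1
  rw [Matrix.det_fin_two, hs]
  have h2 : 0 < m 0 0 * (m 0 0 * m 1 1 - m 0 1 * m 0 1) := by nlinarith
  exact (mul_pos_iff_of_pos_left h0).1 h2

/-- The metric coefficients are smooth: pair the metric, as a section of a bundle of bilinear forms,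
with the images of the constant vector fields under the tangent map of `e.symm`. -/
theorem metricCoeff_contDiffOn (he : e ∈ IsManifold.maximalAtlas (𝓡 2) ∞ M) (i j : Fin 2) :
    ContDiffOn ℝ ∞ (fun x => metricCoeff g e x i j) e.target := by
  have hs := contMDiffOn_symm_of_mem_maximalAtlas he
  have hv : ∀ v : Plane, ContMDiffOn (𝓡 2) (𝓡 2).tangent ∞
      (fun x => (TotalSpace.mk' Plane (e.symm x) (mfderiv (𝓡 2) (𝓡 2) e.symm x v) :
        TangentBundle (𝓡 2) M)) e.target := by
    intro v
    have h1 := hs.contMDiffOn_tangentMapWithin (m := ∞) (by simp)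
      e.open_target.uniqueMDiffOn
    have h2 : ContMDiffOn (𝓡 2) (𝓡 2).tangent ∞
        (fun x : Plane => (⟨x, v⟩ : TangentBundle (𝓡 2) Plane)) e.target :=
      contMDiffOn_vectorSpace_iff_contDiffOn.2 contDiffOn_const
    have h3 := h1.comp h2 (fun x hx => hx)
    refine h3.congr fun x hx => ?_
    simp only [Function.comp, tangentMapWithin]
    rw [mfderivWithin_of_isOpen e.open_target hx]
  have hg : ContMDiffOn (𝓡 2) ((𝓡 2).prod 𝓘(ℝ, Plane →L[ℝ] Plane →L[ℝ] ℝ)) ∞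
      (fun x => TotalSpace.mk' (Plane →L[ℝ] Plane →L[ℝ] ℝ)
        (E := fun p : M => TangentSpace (𝓡 2) p →L[ℝ] TangentSpace (𝓡 2) p →L[ℝ] ℝ)
        (e.symm x) (g.inner (e.symm x))) e.target :=
    g.contMDiff.comp_contMDiffOn hs
  intro x hx
  have key : ContMDiffWithinAt (𝓡 2) ((𝓡 2).prod 𝓘(ℝ, ℝ)) ∞
      (fun x => TotalSpace.mk' ℝ (E := Bundle.Trivial M ℝ) (e.symm x)
        (g.inner (e.symm x) (mfderiv (𝓡 2) (𝓡 2) e.symm x (EuclideanSpace.single i (1 : ℝ)))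
          (mfderiv (𝓡 2) (𝓡 2) e.symm x (EuclideanSpace.single j (1 : ℝ))))) e.target x := by
    apply ContMDiffWithinAt.clm_bundle_apply₂ (F₁ := Plane) (F₂ := Plane)
    · exact hg x hx
    · exact hv _ x hx
    · exact hv _ x hx
  simp only [contMDiffWithinAt_totalSpace] at key
  exact key.2.contDiffWithinAt

theorem smoothMetricOn_metricCoeff (he : e ∈ IsManifold.maximalAtlas (𝓡 2) ∞ M) :
    SmoothMetricOn (metricCoeff g e) e.target where
  isOpen := e.open_target
  smooth := metricCoeff_contDiffOn g he
  symm := fun x _ => metricCoeff_symm g e x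
  pos := fun _ hx => ⟨metricCoeff_pos g he hx 0, metricCoeff_pos g he hx 1⟩
  det_pos := fun _ hx => metricCoeff_det_pos g he hx

/-- The metric coefficients in two charts are related by the coordinate change. -/
theorem isPullback_transition (he : e ∈ IsManifold.maximalAtlas (𝓡 2) ∞ M)
    (he' : e' ∈ IsManifold.maximalAtlas (𝓡 2) ∞ M) :
    IsPullback (metricCoeff g e) (metricCoeff g e') (transition e e')
      (e.symm ≫ₕ e').source e'.target where
  left :=
    { isOpen := (e.symm ≫ₕ e').open_source
      smooth := fun a b => (metricCoeff_contDiffOn g he a b).mono fun _ hx => hx.1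
      symm := fun x _ => metricCoeff_symm g e x
      pos := fun _ hx => ⟨metricCoeff_pos g he hx.1 0, metricCoeff_pos g he hx.1 1⟩
      det_pos := fun _ hx => metricCoeff_det_pos g he hx.1 }
  right := smoothMetricOn_metricCoeff g he'
  smooth := transition_contDiffOn he he'
  mapsTo := fun x hx => e'.map_source hx.2
  eq := by
    intro x hx
    have hx1 : x ∈ e.target := hx.1
    have hx2 : e.symm x ∈ e'.source := hx.2
    have hd := transition_diffAt he he' hx
    have hvec : ∀ i a, vecCoord e' (e.symm x)
        (mfderiv (𝓡 2) (𝓡 2) e.symm x (EuclideanSpace.single i (1 : ℝ))) a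
        = jac (transition e e') x a i := by
      intro i a
      rw [vecCoord_transition he he' (e.map_target hx1) hx2, vecCoord_symm he hx1,
        e.right_inv hx1]
      fin_cases i <;> simp
    ext i j
    have h1 : metricCoeff g e x i j = _ := inner_eq g he' hx2
      (mfderiv (𝓡 2) (𝓡 2) e.symm x (EuclideanSpace.single i (1 : ℝ)))
      (mfderiv (𝓡 2) (𝓡 2) e.symm x (EuclideanSpace.single j (1 : ℝ)))
    rw [h1]
    simp only [hvec, Matrix.mul_apply, Fin.sum_univ_two, Matrix.transpose_apply]
    simp only [transition]
    ring

/-- The Gaussian curvature can be computed in any chart. -/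
theorem gaussianCurvature_eq (he : e ∈ IsManifold.maximalAtlas (𝓡 2) ∞ M) {p : M}
    (hp : p ∈ e.source) : gaussianCurvature g p = curvatureOfCoeff (metricCoeff g e) (e p) := by
  have h0 := IsManifold.chart_mem_maximalAtlas (I := 𝓡 2) (n := ∞) p
  have hp0 := mem_chart_source Plane p
  rw [gaussianCurvature,
    (isPullback_transition g h0 he).curvatureOfCoeff_eq (mem_overlap hp0 hp),
    transition_apply hp0]

theorem gaussianCurvature_symm_eqOn (he : e ∈ IsManifold.maximalAtlas (𝓡 2) ∞ M) :
    EqOn (fun x => gaussianCurvature g (e.symm x)) (curvatureOfCoeff (metricCoeff g e))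
      e.target := by
  intro x hx
  simp only
  rw [gaussianCurvature_eq g he (e.map_target hx), e.right_inv hx]

theorem contDiffOn_gaussianCurvature_symm (he : e ∈ IsManifold.maximalAtlas (𝓡 2) ∞ M) :
    ContDiffOn ℝ ∞ (fun x => gaussianCurvature g (e.symm x)) e.target :=
  (smoothMetricOn_metricCoeff g he).contDiffOn_curvature.congr (gaussianCurvature_symm_eqOn g he)

/-- The gradient in coordinates: `∑ gᵢⱼ (grad h)ʲ = ∂ᵢ h`. -/
theorem metricCoeff_mul_gradient (he : e ∈ IsManifold.maximalAtlas (𝓡 2) ∞ M) {p : M}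
    (hp : p ∈ e.source) {h : M → ℝ} (hh : DifferentiableAt ℝ (fun x => h (e.symm x)) (e p))
    (i : Fin 2) : ∑ j, metricCoeff g e (e p) i j * vecCoord e p (gradient g h p) j
      = partialDeriv i (fun x => h (e.symm x)) (e p) := by
  obtain ⟨z, hz⟩ : ∃ z : TangentSpace (𝓡 2) p, vecCoord e p z = EuclideanSpace.single i 1 :=
    (chart_mdifferentiable he).mfderiv_surjective hp _
  have h1 := gradient_spec g h p z
  rw [mfderiv_eq_sum he hp hh, g.symm, inner_eq g he hp, hz] at h1
  fin_cases i <;> simpa [Fin.sum_univ_two] using h1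

/-- The components of the covariant derivative along a curve, computed in the chart `e`. -/
def covCoord (e : OpenPartialHomeomorph M Plane) (γ : ℝ → M)
    (V : ∀ s : ℝ, TangentSpace (𝓡 2) (γ s)) (t : ℝ) (k : Fin 2) : ℝ :=
  deriv (fun s => vecCoord e (γ s) (V s) k) t
    + ∑ i, ∑ j, christoffel (metricCoeff g e) k i j (e (γ t))
      * deriv (fun s => e (γ s) i) t * vecCoord e (γ t) (V t) j

/-- The chain rule for a function along a plane curve. -/
theorem hasDerivAt_comp_plane {h : Plane → ℝ} {c : ℝ → Plane} {t : ℝ} {c' : Fin 2 → ℝ}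
    (hh : DifferentiableAt ℝ h (c t)) (hc : ∀ k, HasDerivAt (fun s => c s k) (c' k) t) :
    HasDerivAt (fun s => h (c s)) (∑ i, partialDeriv i h (c t) * c' i) t := by
  have h1 : HasDerivAt c (WithLp.toLp 2 c') t := by
    rw [hasDerivAt_iff_hasFDerivAt]
    refine hasFDerivWithinAt_univ.1 (hasFDerivWithinAt_euclidean.2 fun k => ?_)
    refine HasFDerivAt.hasFDerivWithinAt ?_
    convert! (hc k).hasFDerivAt using 1
  have h2 := hh.hasFDerivAt.comp_hasDerivAt t h1
  rw [fderiv_eq_sum] at h2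
  convert! h2 using 1
  simp [mul_comm]

/-- The covariant derivative transforms as a vector. -/
theorem covCoord_transition (he : e ∈ IsManifold.maximalAtlas (𝓡 2) ∞ M)
    (he' : e' ∈ IsManifold.maximalAtlas (𝓡 2) ∞ M) {γ : ℝ → M}
    {V : ∀ s : ℝ, TangentSpace (𝓡 2) (γ s)} {t : ℝ}
    (ht : γ t ∈ e.source) (ht' : γ t ∈ e'.source)
    (hγ : MDifferentiableAt 𝓘(ℝ, ℝ) (𝓡 2) γ t)
    (hV : ∀ k, DifferentiableAt ℝ (fun s => vecCoord e (γ s) (V s) k) t) (a : Fin 2) :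
    covCoord g e' γ V t a
      = ∑ k, jac (transition e e') (e (γ t)) a k * covCoord g e γ V t k := by
  have hP := isPullback_transition g he he'
  have hov := mem_overlap ht ht'
  have hx := vecCoord_velocity he ht hγ
  have hx' := vecCoord_velocity he' ht' hγ
  set φ := transition e e' with hφ
  have hev : ∀ b, (fun s => vecCoord e' (γ s) (V s) b) =ᶠ[nhds t]
      fun s => jac φ (e (γ s)) b 0 * vecCoord e (γ s) (V s) 0
        + jac φ (e (γ s)) b 1 * vecCoord e (γ s) (V s) 1 := by
    intro b
    have h1 := hγ.continuousAt.preimage_mem_nhds (e.open_source.mem_nhds ht)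
    have h2 := hγ.continuousAt.preimage_mem_nhds (e'.open_source.mem_nhds ht')
    filter_upwards [h1, h2] with s hs hs'
    rw [vecCoord_transition he he' hs hs', Fin.sum_univ_two]
  have hJ : ∀ b k, HasDerivAt (fun s => jac φ (e (γ s)) b k)
      (∑ i, pdMat i (jac φ) (e (γ t)) b k * vecCoord e (γ t) (velocity γ t) i) t := fun b k =>
    hasDerivAt_comp_plane (c := fun s => e (γ s)) (h := fun y => jac φ y b k)
      (hP.jac_matDiffAt hov b k) hx
  have hd : ∀ b, deriv (fun s => vecCoord e' (γ s) (V s) b) t = _ := fun b =>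
    (((hJ b 0).mul (hV 0).hasDerivAt).add ((hJ b 1).mul (hV 1).hasDerivAt)).congr_of_eventuallyEq
      (hev b) |>.deriv
  have hgauge : ∀ i b j, (jac φ (e (γ t)) * connMat (metricCoeff g e) i (e (γ t))) b j = _ :=
    fun i b j => congrFun (congrFun (hP.jac_mul_connMat hov i) b) j
  have hφt : φ (e (γ t)) = e' (γ t) := transition_apply ht
  -- Differentiating `J` along the curve produces the terms `∂ᵢJ` of the gauge law.
  simp only [covCoord]
  rw [hd]
  simp only [(hx _).deriv, (hx' _).deriv, vecCoord_transition he he' ht ht']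
  rw [← hφ]
  have hc : ∀ k i j, christoffel (metricCoeff g e) k i j (e (γ t))
      = connMat (metricCoeff g e) i (e (γ t)) k j := fun _ _ _ => rfl
  have hc' : ∀ k i j, christoffel (metricCoeff g e') k i j (e' (γ t))
      = connMat (metricCoeff g e') i (φ (e (γ t))) k j := by
    intro k i j; rw [hφt]; rfl
  simp only [hc, hc']
  simp only [Matrix.mul_apply, Matrix.add_apply, Matrix.smul_apply,
    Fin.sum_univ_two, smul_eq_mul] at hgauge ⊢
  set w := vecCoord e (γ t) (velocity γ t)
  set v := vecCoord e (γ t) (V t)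
  linear_combination (-(w 0 * v 0)) * hgauge 0 a 0 - (w 0 * v 1) * hgauge 0 a 1
    - (w 1 * v 0) * hgauge 1 a 0 - (w 1 * v 1) * hgauge 1 a 1

/-- The covariant derivative can be computed in any chart. -/
theorem vecCoord_covDerivAlong (he : e ∈ IsManifold.maximalAtlas (𝓡 2) ∞ M) {γ : ℝ → M}
    {V : ∀ s : ℝ, TangentSpace (𝓡 2) (γ s)} {t : ℝ} (ht : γ t ∈ e.source)
    (hγ : MDifferentiableAt 𝓘(ℝ, ℝ) (𝓡 2) γ t)
    (hV : ∀ k, DifferentiableAt ℝ (fun s => vecCoord e (γ s) (V s) k) t) (k : Fin 2) :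
    vecCoord e (γ t) (covDerivAlong g γ V t) k = covCoord g e γ V t k := by
  set e0 := chartAt Plane (γ t) with he0
  have h0 := IsManifold.chart_mem_maximalAtlas (I := 𝓡 2) (n := ∞) (γ t)
  have ht0 := mem_chart_source Plane (γ t)
  have hinv : (mfderiv (𝓡 2) (𝓡 2) e0 (γ t)).IsInvertible :=
    ⟨(chart_mdifferentiable h0).mfderiv ht0, rfl⟩
  have h1 : vecCoord e0 (γ t) (covDerivAlong g γ V t)
      = WithLp.toLp 2 fun a => covCoord g e0 γ V t a := hinv.self_apply_inverse _
  have h2 : ∀ a, ∑ i, jac (transition e e0) (e (γ t)) a i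
      * vecCoord e (γ t) (covDerivAlong g γ V t) i
      = ∑ i, jac (transition e e0) (e (γ t)) a i * covCoord g e γ V t i := by
    intro a
    rw [← vecCoord_transition he h0 ht ht0, ← covCoord_transition g he h0 ht ht0 hγ hV, h1]
  have hu := (isPullback_transition g he h0).isUnit_jac (mem_overlap ht ht0)
  have h3 : (jac (transition e e0) (e (γ t))) *ᵥ
      (fun i => vecCoord e (γ t) (covDerivAlong g γ V t) i)
      = (jac (transition e e0) (e (γ t))) *ᵥ (fun i => covCoord g e γ V t i) := funext h2
  exact congrFun (Matrix.mulVec_injective_of_isUnit ((Matrix.isUnit_iff_isUnit_det _).2 hu) h3) k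

end Metric

/-! ### Warped product metrics `du² + h(u) dv²` -/

theorem partialDeriv_comp_fst {h : ℝ → ℝ} {x : Plane} {h' : ℝ} (hh : HasDerivAt h h' (x 0))
    (i : Fin 2) : partialDeriv i (fun y : Plane => h (y 0)) x = if i = 0 then h' else 0 := by
  have h1 : HasFDerivAt (fun y : Plane => y 0) (EuclideanSpace.proj (0 : Fin 2) : Plane →L[ℝ] ℝ) x :=
    (EuclideanSpace.proj (0 : Fin 2) : Plane →L[ℝ] ℝ).hasFDerivAt
  have h2 := hh.comp_hasFDerivAt x h1
  have h3 : partialDeriv i (h ∘ fun y : Plane => y 0) x = if i = 0 then h' else 0 := by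
    rw [partialDeriv, h2.fderiv]
    fin_cases i <;> simp
  exact h3

section Warped

variable {G : Plane → Matrix (Fin 2) (Fin 2) ℝ} {U : Set Plane} {h a : ℝ → ℝ}

/-- The Christoffel symbols of `du² + h(u) dv²`, in terms of the logarithmic derivative `a` of
`h`. -/
theorem warped_connMat (hU : IsOpen U) (hG : ∀ x ∈ U, G x = !![1, 0; 0, h (x 0)])
    (hpos : ∀ x ∈ U, 0 < h (x 0)) (hh : ∀ x ∈ U, HasDerivAt h (a (x 0) * h (x 0)) (x 0))
    {x : Plane} (hx : x ∈ U) :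
    connMat G 0 x = !![0, 0; 0, a (x 0) / 2] ∧
      connMat G 1 x = !![0, -(a (x 0) * h (x 0)) / 2; a (x 0) / 2, 0] := by
  have hp : ∀ i j k, partialDeriv i (fun y => G y j k) x
      = partialDeriv i (fun y => (!![1, 0; 0, h (y 0)] : Matrix (Fin 2) (Fin 2) ℝ) j k) x := by
    intro i j k
    apply partialDeriv_congr
    filter_upwards [hU.mem_nhds hx] with y hy
    rw [hG y hy]
  have h11 := partialDeriv_comp_fst (hh x hx)
  have hinv : (G x)⁻¹ = !![1, 0; 0, (h (x 0))⁻¹] := by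
    apply Matrix.inv_eq_left_inv
    rw [hG x hx]
    have := (hpos x hx).ne'
    ext i j
    fin_cases i <;> fin_cases j <;> simp [Matrix.mul_apply, Fin.sum_univ_two, this]
  have h0 := (hpos x hx).ne'
  constructor <;>
  · rw [connMat_eq, hinv]
    ext l k
    fin_cases l <;> fin_cases k <;>
      simp [Matrix.mul_apply, Fin.sum_univ_two, firstKind, hp, h11, partialDeriv_const]
    all_goals try field_simp

/-- The curvature of `du² + h(u) dv²`, in terms of the logarithmic derivative `a` of `h`. -/
theorem warped_curvature (hU : IsOpen U) (hG : ∀ x ∈ U, G x = !![1, 0; 0, h (x 0)])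
    (hpos : ∀ x ∈ U, 0 < h (x 0)) (hh : ∀ x ∈ U, HasDerivAt h (a (x 0) * h (x 0)) (x 0))
    {x : Plane} (hx : x ∈ U) {a' : ℝ} (ha : HasDerivAt a a' (x 0)) :
    curvatureOfCoeff G x = -a' / 2 - a (x 0) ^ 2 / 4 := by
  have h0 := (hpos x hx).ne'
  obtain ⟨hc0, hc1⟩ := warped_connMat hU hG hpos hh hx
  have hp1 : pdMat 0 (connMat G 1) x 0 1
      = -(a' * h (x 0) + a (x 0) * (a (x 0) * h (x 0))) / 2 := by
    have hev : (fun y => connMat G 1 y 0 1) =ᶠ[nhds x] fun y => -(a (y 0) * h (y 0)) / 2 := by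
      filter_upwards [hU.mem_nhds hx] with y hy
      rw [(warped_connMat hU hG hpos hh hy).2]; simp
    have hd : HasDerivAt (fun s => -(a s * h s) / 2)
        (-(a' * h (x 0) + a (x 0) * (a (x 0) * h (x 0))) / 2) (x 0) :=
      ((ha.mul (hh x hx)).neg).div_const 2
    have := partialDeriv_comp_fst hd 0
    simp only [if_true] at this
    rw [← this]
    exact partialDeriv_congr 0 hev
  have hp0 : pdMat 1 (connMat G 0) x 0 1 = 0 := by
    have hev : (fun y => connMat G 0 y 0 1) =ᶠ[nhds x] fun _ => (0 : ℝ) := by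
      filter_upwards [hU.mem_nhds hx] with y hy
      rw [(warped_connMat hU hG hpos hh hy).1]; simp
    exact (partialDeriv_congr 1 hev).trans (partialDeriv_const _ _ _)
  have hcurv : curvMat G x 0 1 = -(a' * h (x 0) + a (x 0) * (a (x 0) * h (x 0))) / 2
      + a (x 0) * h (x 0) / 2 * (a (x 0) / 2) := by
    simp only [curvMat, Matrix.add_apply, Matrix.sub_apply, hp1, hp0, hc0, hc1]
    simp [Matrix.mul_apply, Fin.sum_univ_two]
    ring
  rw [curvatureOfCoeff_eq, hG x hx]
  simp only [Matrix.mul_apply, Fin.sum_univ_two, Matrix.transpose_apply, Matrix.det_fin_two, hcurv]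
  simp
  field_simp
  ring

end Warped

/-! ### Profile functions -/

section Profile

variable {c : ℝ} {f : ℝ → ℝ} {J : Set ℝ}

/-- The metric coefficient `f^(-3/2)` of a normal form, with a real exponent. -/
def warp (f : ℝ → ℝ) (u : ℝ) : ℝ := 1 / f u ^ (3 / 2 : ℝ)

theorem warp_pos {u : ℝ} (hf : 0 < f u) : 0 < warp f u := by unfold warp; positivity

theorem hasDerivAt_warp {u f' : ℝ} (hf : 0 < f u) (hd : HasDerivAt f f' u) :
    HasDerivAt (warp f) (-(3 / 2) * (f' / f u) * warp f u) u := by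
  have h1 := hd.rpow_const (p := 3 / 2) (Or.inl hf.ne')
  have h2 := h1.fun_inv (by positivity)
  have h3 : warp f = fun y => (f y ^ (3 / 2 : ℝ))⁻¹ := by
    ext y; simp [warp]
  rw [h3]
  convert! h2 using 1
  rw [Real.rpow_sub_one hf.ne']
  have : f u ^ (3 / 2 : ℝ) ≠ 0 := by positivity
  field_simp

/-- The curvature of `du² + f(u)^(-3/2) dv²`. -/
theorem curvature_warp {G : Plane → Matrix (Fin 2) (Fin 2) ℝ} {U : Set Plane} (hU : IsOpen U)
    (hG : ∀ x ∈ U, G x = !![1, 0; 0, warp f (x 0)]) (hf : ∀ x ∈ U, 0 < f (x 0))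
    (hd : ∀ x ∈ U, HasDerivAt f (deriv f (x 0)) (x 0)) {x : Plane} (hx : x ∈ U) {f'' : ℝ}
    (hd' : HasDerivAt (deriv f) f'' (x 0)) :
    curvatureOfCoeff G x
      = 3 / 4 * (f'' / f (x 0)) - 21 / 16 * (deriv f (x 0) / f (x 0)) ^ 2 := by
  have h0 := (hf x hx).ne'
  have ha : HasDerivAt (fun u => -(3 / 2) * (deriv f u / f u)) _ (x 0) :=
    (hd'.div (hd x hx) h0).const_mul (-(3 / 2))
  rw [warped_curvature (a := fun u => -(3 / 2) * (deriv f u / f u)) hU hG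
    (fun y hy => warp_pos (hf y hy)) (fun y hy => hasDerivAt_warp (hf y hy) (hd y hy)) hx ha]
  field_simp
  ring

theorem IsProfileOn.hasDerivAt (hf : IsProfileOn c f J) (hJ : IsOpen J) {u : ℝ} (hu : u ∈ J) :
    HasDerivAt f (deriv f u) u :=
  ((hf.smooth.contDiffAt (hJ.mem_nhds hu)).differentiableAt (by simp)).hasDerivAt

theorem IsProfileOn.hasDerivAt_deriv (hf : IsProfileOn c f J) (hJ : IsOpen J) {u : ℝ}
    (hu : u ∈ J) : HasDerivAt (deriv f) (deriv (deriv f) u) u :=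
  (((hf.smooth.deriv_of_isOpen hJ (m := ∞) (by simp)).contDiffAt
    (hJ.mem_nhds hu)).differentiableAt (by simp)).hasDerivAt

theorem hasDerivAt_curvaturePoly (c u : ℝ) :
    HasDerivAt (fun y : ℝ => -1 - 3 * y ^ 2 - c ^ 2 * y ^ 3) (-(6 * u + 3 * c ^ 2 * u ^ 2)) u := by
  convert! (((hasDerivAt_pow 2 u).const_mul 3).const_sub (-1)).fun_sub
    ((hasDerivAt_pow 3 u).const_mul (c ^ 2)) using 1
  simp; ring

/-- A positive root is automatically unique, since `3 y² + c² y³` increases on `y > 0`. -/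
theorem isUniquePositiveRoot_of_eq {c K y : ℝ} (hy : 0 < y)
    (h : 1 + K + 3 * y ^ 2 + c ^ 2 * y ^ 3 = 0) : IsUniquePositiveRoot c K y := by
  refine ⟨⟨hy, h⟩, fun z hz hz' => ?_⟩
  have h1 : (z - y) * (3 * (z + y) + c ^ 2 * (z ^ 2 + z * y + y ^ 2)) = 0 := by
    linear_combination hz' - h
  rcases mul_eq_zero.1 h1 with h2 | h2
  · linarith
  · exact absurd h2 (by positivity)

end Profile

/-! ### Geometry of a normal form -/

section NormalForm

variable {M : Type*} [TopologicalSpace M] [ChartedSpace Plane M] [IsManifold (𝓡 2) ∞ M]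

/-- `e` is a positively oriented chart in which `g = du² + f(u)^(-3/2) dv²`, where `f` is a profile
function. -/
structure IsNormalForm (g : SurfaceMetric M) (c : ℝ) (e : OpenPartialHomeomorph M Plane)
    (f : ℝ → ℝ) : Prop where
  positive : IsPositiveChart e
  profile : IsProfileOn c f ((fun x : Plane => x 0) '' e.target)
  metric : ∀ x ∈ e.target, metricCoeff g e x = !![1, 0; 0, warp f (x 0)]

theorem hasNormalFormAt_iff {g : SurfaceMetric M} {c : ℝ} {p : M} :
    HasNormalFormAt g c p ↔ ∃ e f, p ∈ e.source ∧ IsNormalForm g c e f :=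
  ⟨fun ⟨e, f, hp, h1, h2, h3⟩ => ⟨e, f, hp, h1, h2, h3⟩,
    fun ⟨e, f, hp, h⟩ => ⟨e, f, hp, h.1, h.2, h.3⟩⟩

theorem isOpen_fst_image {U : Set Plane} (hU : IsOpen U) :
    IsOpen ((fun x : Plane => x 0) '' U) := by
  have : IsOpenMap (EuclideanSpace.proj (0 : Fin 2) : Plane →L[ℝ] ℝ) :=
    ContinuousLinearMap.isOpenMap _ fun r => ⟨EuclideanSpace.single 0 r, by simp⟩
  exact this U hU

namespace IsNormalForm

variable {g : SurfaceMetric M} {c : ℝ} {e : OpenPartialHomeomorph M Plane} {f : ℝ → ℝ}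

theorem isOpen_image (_ : IsNormalForm g c e f) : IsOpen ((fun x : Plane => x 0) '' e.target) :=
  isOpen_fst_image e.open_target

theorem hasDerivAt_profile (h : IsNormalForm g c e f) {x : Plane} (hx : x ∈ e.target) :
    HasDerivAt f (deriv f (x 0)) (x 0) := h.profile.hasDerivAt h.isOpen_image ⟨x, hx, rfl⟩

theorem profile_pos (h : IsNormalForm g c e f) {x : Plane} (hx : x ∈ e.target) : 0 < f (x 0) :=
  h.profile.pos _ ⟨x, hx, rfl⟩

theorem curvature_eq (h : IsNormalForm g c e f) {x : Plane} (hx : x ∈ e.target) :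
    curvatureOfCoeff (metricCoeff g e) x = -1 - 3 * f (x 0) ^ 2 - c ^ 2 * f (x 0) ^ 3 := by
  have hf := h.profile_pos hx
  have hmem : x 0 ∈ (fun x : Plane => x 0) '' e.target := ⟨x, hx, rfl⟩
  rw [curvature_warp e.open_target h.metric (fun y hy => h.profile_pos hy)
    (fun y hy => h.hasDerivAt_profile hy) hx (h.profile.hasDerivAt_deriv h.isOpen_image hmem)]
  have hode := h.profile.ode _ hmem
  field_simp
  linear_combination 48 * hode

theorem gaussianCurvature_eq (h : IsNormalForm g c e f) {q : M} (hq : q ∈ e.source) :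
    gaussianCurvature g q = -1 - 3 * f (e q 0) ^ 2 - c ^ 2 * f (e q 0) ^ 3 := by
  rw [BiconservativeSurface.gaussianCurvature_eq g h.positive.1 hq,
    h.curvature_eq (e.map_source hq)]

theorem isUniquePositiveRoot (h : IsNormalForm g c e f) {q : M} (hq : q ∈ e.source) :
    IsUniquePositiveRoot c (gaussianCurvature g q) (f (e q 0)) :=
  isUniquePositiveRoot_of_eq (h.profile_pos (e.map_source hq)) (by
    rw [h.gaussianCurvature_eq hq]; ring)

/-- The norm of `grad K` in terms of the profile function. -/
def gradNorm (c : ℝ) (f : ℝ → ℝ) (u : ℝ) : ℝ := (6 * f u + 3 * c ^ 2 * f u ^ 2) * deriv f u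

theorem gradNorm_pos (h : IsNormalForm g c e f) {x : Plane} (hx : x ∈ e.target) :
    0 < gradNorm c f (x 0) := by
  have := h.profile_pos hx
  have := h.profile.deriv_pos _ ⟨x, hx, rfl⟩
  unfold gradNorm; positivity

theorem partialDeriv_curvature (h : IsNormalForm g c e f) {x : Plane} (hx : x ∈ e.target)
    (i : Fin 2) : partialDeriv i (fun x => gaussianCurvature g (e.symm x)) x
      = if i = 0 then -gradNorm c f (x 0) else 0 := by
  have hev : (fun x => gaussianCurvature g (e.symm x)) =ᶠ[nhds x]
      fun x => -1 - 3 * f (x 0) ^ 2 - c ^ 2 * f (x 0) ^ 3 := by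
    filter_upwards [e.open_target.mem_nhds hx] with y hy
    rw [h.gaussianCurvature_eq (e.map_target hy), e.right_inv hy]
  rw [partialDeriv_congr i hev]
  have hd := h.hasDerivAt_profile hx
  have hd' : HasDerivAt (fun u => -1 - 3 * f u ^ 2 - c ^ 2 * f u ^ 3) (-gradNorm c f (x 0)) (x 0) := by
    have h1 := (hasDerivAt_curvaturePoly c (f (x 0))).comp (x 0) hd
    rwa [neg_mul] at h1
  exact partialDeriv_comp_fst hd' i

theorem diffAt_curvature (h : IsNormalForm g c e f) {x : Plane} (hx : x ∈ e.target) :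
    DifferentiableAt ℝ (fun x => gaussianCurvature g (e.symm x)) x :=
  differentiableAt_of_contDiffOn e.open_target
    (contDiffOn_gaussianCurvature_symm g h.positive.1) hx

theorem vecCoord_gradient (h : IsNormalForm g c e f) {q : M} (hq : q ∈ e.source) :
    vecCoord e q (gradient g (gaussianCurvature g) q) 0 = -gradNorm c f (e q 0) ∧
    vecCoord e q (gradient g (gaussianCurvature g) q) 1 = 0 := by
  have hx := e.map_source hq
  have h0 := metricCoeff_mul_gradient g h.positive.1 hq (h.diffAt_curvature hx)
  simp only [h.partialDeriv_curvature hx, h.metric _ hx, Fin.sum_univ_two] at h0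
  have h1 := h0 0
  have h2 := h0 1
  have := (warp_pos (h.profile_pos hx)).ne'
  simp at h1 h2
  exact ⟨h1, by tauto⟩

theorem inner_eq (h : IsNormalForm g c e f) {q : M} (hq : q ∈ e.source)
    (w z : TangentSpace (𝓡 2) q) : g.inner q w z
      = vecCoord e q w 0 * vecCoord e q z 0
        + warp f (e q 0) * vecCoord e q w 1 * vecCoord e q z 1 := by
  rw [BiconservativeSurface.inner_eq g h.positive.1 hq, h.metric _ (e.map_source hq)]
  simp [Fin.sum_univ_two]

theorem vecNorm_gradient (h : IsNormalForm g c e f) {q : M} (hq : q ∈ e.source) :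
    vecNorm g (gradient g (gaussianCurvature g) q) = gradNorm c f (e q 0) := by
  rw [vecNorm, h.inner_eq hq, (h.vecCoord_gradient hq).1, (h.vecCoord_gradient hq).2]
  have := h.gradNorm_pos (e.map_source hq)
  rw [mul_zero, add_zero, neg_mul_neg, Real.sqrt_mul_self this.le]

/-- The geodesic curvature `(3/4) f'/f` of the level curves. -/
def levelCurvature (f : ℝ → ℝ) (u : ℝ) : ℝ := 3 / 4 * (deriv f u / f u)

theorem levelCurvature_pos (h : IsNormalForm g c e f) {x : Plane} (hx : x ∈ e.target) :
    0 < levelCurvature f (x 0) := by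
  have := h.profile_pos hx
  have := h.profile.deriv_pos _ ⟨x, hx, rfl⟩
  unfold levelCurvature; positivity

/-- The geodesic curvature `(3/4) f'/f` is the expression `-|grad K| / (4 (K + f² + 1))`. -/
theorem levelCurvature_eq (h : IsNormalForm g c e f) {q : M} (hq : q ∈ e.source) :
    levelCurvature f (e q 0) = -(1 / 4) * (vecNorm g (gradient g (gaussianCurvature g) q)
      / (gaussianCurvature g q + f (e q 0) ^ 2 + 1)) := by
  rw [h.vecNorm_gradient hq, h.gaussianCurvature_eq hq]
  have hf := h.profile_pos (e.map_source hq)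
  have h1 : -1 - 3 * f (e q 0) ^ 2 - c ^ 2 * f (e q 0) ^ 3 + f (e q 0) ^ 2 + 1
      = -(f (e q 0) ^ 2 * (2 + c ^ 2 * f (e q 0))) := by ring
  have h2 : (2 + c ^ 2 * f (e q 0)) ≠ 0 := by positivity
  rw [h1, levelCurvature, gradNorm]
  field_simp
  ring

end IsNormalForm

/-- The unit normal `-grad K / |grad K|` of the level curves of `K`. -/
def levelNormal (g : SurfaceMetric M) (q : M) : TangentSpace (𝓡 2) q :=
  -(vecNorm g (gradient g (gaussianCurvature g) q))⁻¹ • gradient g (gaussianCurvature g) q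

namespace IsNormalForm

variable {g : SurfaceMetric M} {c : ℝ} {e : OpenPartialHomeomorph M Plane} {f : ℝ → ℝ}

theorem vecCoord_levelNormal (h : IsNormalForm g c e f) {q : M} (hq : q ∈ e.source) :
    vecCoord e q (levelNormal g q) 0 = 1 ∧ vecCoord e q (levelNormal g q) 1 = 0 := by
  have h0 := (h.gradNorm_pos (e.map_source hq)).ne'
  rw [levelNormal, vecCoord_smul]
  simp [h.vecCoord_gradient hq, h.vecNorm_gradient hq, h0]

section LevelCurve

variable {γ : ℝ → M} {a b t : ℝ}

/-- In a normal form, the level curves of `K` run along the lines `u = const`, in the direction of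
decreasing `v`. -/
theorem vecCoord_velocity (h : IsNormalForm g c e f)
    (hγ : IsLevelCurveOn g (gaussianCurvature g) γ a b) (ht : t ∈ Ioo a b)
    (hq : γ t ∈ e.source) :
    vecCoord e (γ t) (velocity γ t) 0 = 0 ∧
    vecCoord e (γ t) (velocity γ t) 1 = -(Real.sqrt (warp f (e (γ t) 0)))⁻¹ := by
  have hx := e.map_source hq
  have hmd := mdifferentiableAt_curve hγ.smooth ht
  have hv := BiconservativeSurface.vecCoord_velocity h.positive.1 hq hmd
  have hg := h.gradNorm_pos hx
  have hw := warp_pos (h.profile_pos hx)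
  have hK : HasDerivAt (fun s => gaussianCurvature g (e.symm (e (γ s)))) _ t :=
    hasDerivAt_comp_plane (c := fun s => e (γ s)) (h := fun x => gaussianCurvature g (e.symm x))
      (h.diffAt_curvature hx) hv
  have hK0 : HasDerivAt (fun s => gaussianCurvature g (e.symm (e (γ s)))) 0 t := by
    obtain ⟨k, hk⟩ := hγ.level
    refine (hasDerivAt_const t k).congr_of_eventuallyEq ?_
    filter_upwards [isOpen_Ioo.mem_nhds ht,
      hmd.continuousAt.preimage_mem_nhds (e.open_source.mem_nhds hq)] with s hs hs'
    rw [e.left_inv hs', hk s hs]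
  have h1 := hK.unique hK0
  simp [h.partialDeriv_curvature hx, hg.ne'] at h1
  refine ⟨h1, ?_⟩
  have h2 := hγ.unit_speed t ht
  rw [vecNorm, h.inner_eq hq, h1, Real.sqrt_eq_one] at h2
  have h3 := (isPositivePair_iff h.positive hq _ _).1 (hγ.oriented t ht)
  rw [(h.vecCoord_gradient hq).1, (h.vecCoord_gradient hq).2] at h3
  set y := vecCoord e (γ t) (velocity γ t) 1
  have hy : y < 0 := by nlinarith
  have hs := Real.sqrt_pos.2 hw
  have h4 : (Real.sqrt (warp f (e (γ t) 0)) * -y) = 1 := by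
    rw [← Real.sqrt_sq (neg_pos.2 hy).le, ← Real.sqrt_mul hw.le, Real.sqrt_eq_one]
    linarith
  have := eq_inv_of_mul_eq_one_right h4
  linarith

/-- The derivative along a level curve of a function of `u`. -/
theorem hasDerivAt_comp_level (h : IsNormalForm g c e f)
    (hγ : IsLevelCurveOn g (gaussianCurvature g) γ a b) (ht : t ∈ Ioo a b)
    (hq : γ t ∈ e.source) {F : ℝ → ℝ} (hF : DifferentiableAt ℝ F (e (γ t) 0)) :
    HasDerivAt (fun s => F (e (γ s) 0)) 0 t := by
  have hv := BiconservativeSurface.vecCoord_velocity h.positive.1 hq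
    (mdifferentiableAt_curve hγ.smooth ht) 0
  rw [(h.vecCoord_velocity hγ ht hq).1] at hv
  have h1 := hF.hasDerivAt.comp t hv
  rwa [mul_zero] at h1

/-- Along a level curve of `K`, the normal `-grad K / |grad K|` and the curvature `(3/4) f'/f`
satisfy the equations of a circle. -/
theorem circle_equations (h : IsNormalForm g c e f)
    (hγ : IsLevelCurveOn g (gaussianCurvature g) γ a b) (ht : t ∈ Ioo a b)
    (hq : γ t ∈ e.source) :
    vecNorm g (levelNormal g (γ t)) = 1 ∧
    g.inner (γ t) (velocity γ t) (levelNormal g (γ t)) = 0 ∧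
    IsPositivePair (γ t) (velocity γ t) (levelNormal g (γ t)) ∧
    covDerivAlong g γ (velocity γ) t = levelCurvature f (e (γ t) 0) • levelNormal g (γ t) ∧
    covDerivAlong g γ (fun s => levelNormal g (γ s)) t
      = -levelCurvature f (e (γ t) 0) • velocity γ t := by
  have hx := e.map_source hq
  have hmd := mdifferentiableAt_curve hγ.smooth ht
  have hv := BiconservativeSurface.vecCoord_velocity h.positive.1 hq hmd
  obtain ⟨hv0, hv1⟩ := h.vecCoord_velocity hγ ht hq
  obtain ⟨hn0, hn1⟩ := h.vecCoord_levelNormal hq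
  have hw := warp_pos (h.profile_pos hx)
  have hsw := Real.sqrt_pos.2 hw
  have hnear : ∀ᶠ s in nhds t, s ∈ Ioo a b ∧ γ s ∈ e.source := by
    filter_upwards [isOpen_Ioo.mem_nhds ht,
      hmd.continuousAt.preimage_mem_nhds (e.open_source.mem_nhds hq)] with s hs hs'
    exact ⟨hs, hs'⟩
  have hV0 : HasDerivAt (fun s => vecCoord e (γ s) (velocity γ s) 0) 0 t :=
    (hasDerivAt_const t 0).congr_of_eventuallyEq (by
      filter_upwards [hnear] with s hs using (h.vecCoord_velocity hγ hs.1 hs.2).1)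
  have hV1 : HasDerivAt (fun s => vecCoord e (γ s) (velocity γ s) 1) 0 t := by
    have hF : DifferentiableAt ℝ (fun u => -(Real.sqrt (warp f u))⁻¹) (e (γ t) 0) :=
      (((hasDerivAt_warp (h.profile_pos hx) (h.hasDerivAt_profile hx)).differentiableAt.sqrt
        hw.ne').inv hsw.ne').neg
    refine (h.hasDerivAt_comp_level hγ ht hq hF).congr_of_eventuallyEq ?_
    filter_upwards [hnear] with s hs using (h.vecCoord_velocity hγ hs.1 hs.2).2
  have hN0 : HasDerivAt (fun s => vecCoord e (γ s) (levelNormal g (γ s)) 0) 0 t :=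
    (hasDerivAt_const t 1).congr_of_eventuallyEq (by
      filter_upwards [hnear] with s hs using (h.vecCoord_levelNormal hs.2).1)
  have hN1 : HasDerivAt (fun s => vecCoord e (γ s) (levelNormal g (γ s)) 1) 0 t :=
    (hasDerivAt_const t 0).congr_of_eventuallyEq (by
      filter_upwards [hnear] with s hs using (h.vecCoord_levelNormal hs.2).2)
  obtain ⟨hc0, hc1⟩ := warped_connMat (a := fun u => -(3 / 2) * (deriv f u / f u)) e.open_target
    h.metric (fun y hy => warp_pos (h.profile_pos hy))
    (fun y hy => hasDerivAt_warp (h.profile_pos hy) (h.hasDerivAt_profile hy)) hx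
  have hC0 : ∀ k j, christoffel (metricCoeff g e) k 0 j (e (γ t)) = _ :=
    fun k j => congrFun (congrFun hc0 k) j
  have hC1 : ∀ k j, christoffel (metricCoeff g e) k 1 j (e (γ t)) = _ :=
    fun k j => congrFun (congrFun hc1 k) j
  have hsq : (Real.sqrt (warp f (e (γ t) 0)))⁻¹ * (Real.sqrt (warp f (e (γ t) 0)))⁻¹
      = (warp f (e (γ t) 0))⁻¹ := by
    rw [← mul_inv, Real.mul_self_sqrt hw.le]
  refine ⟨?_, ?_, ?_, ?_, ?_⟩
  · rw [vecNorm, h.inner_eq hq, hn0, hn1]; simp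
  · rw [h.inner_eq hq, hv0, hn1]; simp
  · rw [isPositivePair_iff h.positive hq, hv0, hv1, hn0, hn1]
    simp only [mul_zero, mul_one, zero_sub, neg_neg]
    positivity
  · refine vecCoord_injective h.positive.1 hq ?_
    ext k
    rw [vecCoord_covDerivAlong g h.positive.1 hq hmd (by
      intro k; fin_cases k; exacts [hV0.differentiableAt, hV1.differentiableAt]), vecCoord_smul]
    simp only [covCoord, (hv _).deriv, Fin.sum_univ_two, hC0, hC1]
    fin_cases k
    · simp [hV0.deriv, hv0, hv1, hn0, levelCurvature]
      rw [mul_assoc, hsq]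
      field_simp
      ring
    · simp [hV1.deriv, hv0, hn1]
  · refine vecCoord_injective h.positive.1 hq ?_
    ext k
    rw [vecCoord_covDerivAlong g h.positive.1 hq hmd (by
      intro k; fin_cases k; exacts [hN0.differentiableAt, hN1.differentiableAt]), vecCoord_smul]
    simp only [covCoord, (hv _).deriv, Fin.sum_univ_two, hC0, hC1]
    fin_cases k
    · simp [hN0.deriv, hv0, hn1]
    · simp [hN1.deriv, hv0, hv1, hn0, hn1, levelCurvature]
      ring

end LevelCurve

end IsNormalForm

/-- If `M` is covered by normal forms with the same constant, then the level curves of `K` are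
circles of the asserted curvature. -/
theorem hasCircularLevelCurves_of_hasNormalFormAt {g : SurfaceMetric M} {c : ℝ}
    (hN : ∀ p, HasNormalFormAt g c p) : HasCircularLevelCurves g c := by
  simp only [hasNormalFormAt_iff] at hN
  choose E F hE hF using hN
  refine ⟨fun p => ?_, fun p h0 => ?_, fun p => F p (E p p 0),
    fun p => (hF p).isUniquePositiveRoot (hE p), fun γ a b hγ => ?_⟩
  · rw [(hF p).gaussianCurvature_eq (hE p)]
    have := (hF p).profile_pos ((E p).map_source (hE p))
    have : 0 < 3 * F p (E p p 0) ^ 2 + c ^ 2 * F p (E p p 0) ^ 3 := by positivity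
    linarith
  · have h1 := (hF p).vecNorm_gradient (hE p)
    have h2 := (hF p).gradNorm_pos ((E p).map_source (hE p))
    rw [← h1, h0] at h2
    have h3 : vecNorm g (0 : TangentSpace (𝓡 2) p) = 0 := by
      rw [vecNorm, map_zero]; exact Real.sqrt_zero
    exact h2.ne' h3
  · set κ : ℝ → ℝ := fun t => IsNormalForm.levelCurvature (F (γ t)) (E (γ t) (γ t) 0) with hκ
    -- `κ` is an expression in geometric quantities, so any normal form may be used to compute it.
    have hroot : ∀ p q, q ∈ (E p).source → F p (E p q 0) = F q (E q q 0) := fun p q hq =>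
      ((hF q).isUniquePositiveRoot (hE q)).2 _ ((hF p).isUniquePositiveRoot hq).1.1
        ((hF p).isUniquePositiveRoot hq).1.2
    have hκ' : ∀ p t, γ t ∈ (E p).source →
        κ t = IsNormalForm.levelCurvature (F p) (E p (γ t) 0) := by
      intro p t ht
      rw [hκ]
      simp only
      rw [(hF p).levelCurvature_eq ht, (hF (γ t)).levelCurvature_eq (hE _), hroot p _ ht]
    have hd : ∀ t ∈ Ioo a b, HasDerivAt κ 0 t := by
      intro t ht
      have hmem := hE (γ t)
      have hx := (E (γ t)).map_source hmem
      have h := hF (γ t)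
      have hdiff : DifferentiableAt ℝ (IsNormalForm.levelCurvature (F (γ t)))
          (E (γ t) (γ t) 0) :=
        (((h.profile.hasDerivAt_deriv h.isOpen_image ⟨_, hx, rfl⟩).div
          (h.hasDerivAt_profile hx) (h.profile_pos hx).ne').const_mul (3 / 4)).differentiableAt
      refine (h.hasDerivAt_comp_level hγ ht hmem hdiff).congr_of_eventuallyEq ?_
      have hmd := mdifferentiableAt_curve hγ.smooth ht
      filter_upwards [hmd.continuousAt.preimage_mem_nhds
        ((E (γ t)).open_source.mem_nhds hmem)] with s hs using hκ' _ _ hs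
    obtain ⟨k, hk⟩ := isOpen_Ioo.exists_is_const_of_deriv_eq_zero (isPreconnected_Ioo (a := a) (b := b))
      (fun t ht => (hd t ht).differentiableAt.differentiableWithinAt) (fun t ht => (hd t ht).deriv)
    obtain ⟨t0, ht0⟩ : (Ioo a b).Nonempty := nonempty_Ioo.2 hγ.nonempty
    refine ⟨k, ?_, ⟨fun t => levelNormal g (γ t), fun t ht => ?_⟩, fun t ht => ?_⟩
    · rw [← hk t0 ht0]
      exact (hF _).levelCurvature_pos ((E _).map_source (hE _))
    · obtain ⟨h1, h2, h3, h4, h5⟩ := (hF (γ t)).circle_equations hγ ht (hE _)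
      rw [← hk t ht]
      exact ⟨hγ.unit_speed t ht, h1, h2, h3, h4, h5⟩
    · rw [← hk t ht]
      exact (hF _).levelCurvature_eq (hE _)

/-! ### The constant of a normal form is determined by the metric -/

namespace IsNormalForm

variable {g : SurfaceMetric M} {c c' : ℝ} {e e' : OpenPartialHomeomorph M Plane} {f f' : ℝ → ℝ}

/-- In a normal form there is a level curve of `K` through every point. -/
theorem exists_levelCurve (h : IsNormalForm g c e f) {p : M} (hp : p ∈ e.source) :
    ∃ (γ : ℝ → M) (ε : ℝ), 0 < ε ∧ γ 0 = p ∧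
      IsLevelCurveOn g (gaussianCurvature g) γ (-ε) ε := by
  have hx := e.map_source hp
  set η : ℝ := -(Real.sqrt (warp f (e p 0)))⁻¹ with hη
  have hw := warp_pos (h.profile_pos hx)
  have hsw := Real.sqrt_pos.2 hw
  set ℓ : ℝ → Plane := fun s => e p + s • EuclideanSpace.single 1 η with hℓ
  have hℓs : ContDiff ℝ ∞ ℓ := contDiff_const.add (contDiff_id.smul contDiff_const)
  have hℓ0 : ∀ s, ℓ s 0 = e p 0 := by intro s; simp [hℓ]
  have hℓ1 : ∀ s, ℓ s 1 = e p 1 + s * η := by intro s; simp [hℓ]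
  obtain ⟨ε, hε, hball⟩ : ∃ ε > 0, Metric.ball (0 : ℝ) ε ⊆ ℓ ⁻¹' e.target :=
    Metric.mem_nhds_iff.1 (hℓs.continuous.continuousAt.preimage_mem_nhds
      (e.open_target.mem_nhds (by simpa [hℓ] using hx)))
  rw [Real.ball_eq_Ioo, zero_sub, zero_add] at hball
  have hsm : ContMDiffOn 𝓘(ℝ, ℝ) (𝓡 2) ∞ (fun s => e.symm (ℓ s)) (Ioo (-ε) ε) :=
    (contMDiffOn_symm_of_mem_maximalAtlas h.positive.1).comp hℓs.contMDiff.contMDiffOn hball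
  have hvel : ∀ t ∈ Ioo (-ε) ε,
      vecCoord e (e.symm (ℓ t)) (velocity (fun s => e.symm (ℓ s)) t) 0 = 0 ∧
      vecCoord e (e.symm (ℓ t)) (velocity (fun s => e.symm (ℓ s)) t) 1 = η := by
    intro t ht
    have hmd := mdifferentiableAt_curve hsm ht
    have hv := BiconservativeSurface.vecCoord_velocity h.positive.1
      (e.map_target (hball ht)) hmd
    have hev : ∀ᶠ s in nhds t, e (e.symm (ℓ s)) = ℓ s := by
      filter_upwards [isOpen_Ioo.mem_nhds ht] with s hs using e.right_inv (hball hs)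
    constructor
    · refine (hv 0).unique ((hasDerivAt_const t (e p 0)).congr_of_eventuallyEq ?_)
      filter_upwards [hev] with s hs
      rw [hs, hℓ0]
    · have h1 : HasDerivAt (fun s => e p 1 + s * η) η t := by
        simpa using ((hasDerivAt_id t).mul_const η).const_add (e p 1)
      refine (hv 1).unique (h1.congr_of_eventuallyEq ?_)
      filter_upwards [hev] with s hs
      rw [hs, hℓ1]
  refine ⟨fun s => e.symm (ℓ s), ε, hε, by simp [hℓ, hp], by linarith, hsm, ?_, ?_, ?_⟩
  · refine ⟨gaussianCurvature g p, fun t ht => ?_⟩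
    rw [h.gaussianCurvature_eq (e.map_target (hball ht)), h.gaussianCurvature_eq hp,
      e.right_inv (hball ht), hℓ0]
  · intro t ht
    rw [vecNorm, h.inner_eq (e.map_target (hball ht)), (hvel t ht).1, (hvel t ht).2,
      e.right_inv (hball ht), hℓ0, mul_assoc, hη, neg_mul_neg, ← mul_inv,
      Real.mul_self_sqrt hw.le, mul_inv_cancel₀ hw.ne']
    simp
  · intro t ht
    have hq := e.map_target (hball ht)
    rw [isPositivePair_iff h.positive hq, (hvel t ht).1, (hvel t ht).2,
      (h.vecCoord_gradient hq).1, (h.vecCoord_gradient hq).2]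
    have h1 := h.gradNorm_pos (e.map_source hq)
    rw [zero_mul, sub_zero, hη, neg_mul_neg]
    positivity

/-- Two normal forms at the same point have the same `c²`. The equation `∇_γ' γ' = κ N` on a level
curve shows that `κ = (3/4) f'/f` is the same for both; then so is
`|grad K| / (4 κ) + 1 + K = -f²`, hence `f`, hence `c² = -(1 + K + 3 f²) / f³`. -/
theorem sq_const_unique (h : IsNormalForm g c e f) (h' : IsNormalForm g c' e' f') {p : M}
    (hp : p ∈ e.source) (hp' : p ∈ e'.source) : c ^ 2 = c' ^ 2 := by
  obtain ⟨γ, ε, hε, rfl, hγ⟩ := h.exists_levelCurve hp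
  have h0 : (0 : ℝ) ∈ Ioo (-ε) ε := ⟨by linarith, hε⟩
  have hκ : levelCurvature f (e (γ 0) 0) = levelCurvature f' (e' (γ 0) 0) := by
    have h1 := (h.circle_equations hγ h0 hp).2.2.2.1
    have h2 := (h'.circle_equations hγ h0 hp').2.2.2.1
    have h3 := congrArg (fun w => vecCoord e (γ 0) w 0) (h1.symm.trans h2)
    simpa [vecCoord_smul, (h.vecCoord_levelNormal hp).1] using h3
  have hn := (h.vecNorm_gradient hp).symm.trans (h'.vecNorm_gradient hp')
  have hK := (h.gaussianCurvature_eq hp).symm.trans (h'.gaussianCurvature_eq hp')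
  have hκ0 := h.levelCurvature_pos (e.map_source hp)
  have e1 : gradNorm c f (e (γ 0) 0) = levelCurvature f (e (γ 0) 0)
      * (4 * (2 * f (e (γ 0) 0) ^ 2 + c ^ 2 * f (e (γ 0) 0) ^ 3)) := by
    have := (h.profile_pos (e.map_source hp)).ne'
    rw [gradNorm, levelCurvature]; field_simp; ring
  have e2 : gradNorm c' f' (e' (γ 0) 0) = levelCurvature f' (e' (γ 0) 0)
      * (4 * (2 * f' (e' (γ 0) 0) ^ 2 + c' ^ 2 * f' (e' (γ 0) 0) ^ 3)) := by
    have := (h'.profile_pos (e'.map_source hp')).ne'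
    rw [gradNorm, levelCurvature]; field_simp; ring
  rw [e1, e2, ← hκ] at hn
  have hn' := mul_left_cancel₀ hκ0.ne' hn
  have hf := h.profile_pos (e.map_source hp)
  have hf' := h'.profile_pos (e'.map_source hp')
  have hsq : f (e (γ 0) 0) ^ 2 = f' (e' (γ 0) 0) ^ 2 := by linarith
  have heq : f (e (γ 0) 0) = f' (e' (γ 0) 0) :=
    (sq_eq_sq₀ hf.le hf'.le).1 hsq
  rw [heq] at hn'
  have h3 : c ^ 2 * f' (e' (γ 0) 0) ^ 3 = c' ^ 2 * f' (e' (γ 0) 0) ^ 3 := by linarith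
  exact mul_right_cancel₀ (by positivity) h3

end IsNormalForm

/-- The normal form involves `c` only through `c²`. -/
theorem hasNormalFormAt_congr_sq {g : SurfaceMetric M} {c c' : ℝ} (hc : c ^ 2 = c' ^ 2) {p : M}
    (h : HasNormalFormAt g c p) : HasNormalFormAt g c' p := by
  obtain ⟨e, f, hp, h1, h2, h3⟩ := h
  exact ⟨e, f, hp, h1, ⟨h2.smooth, h2.pos, h2.deriv_pos, by simpa only [hc] using h2.ode⟩, h3⟩

/-- On a connected surface, local normal forms all have the same constant up to sign. -/
theorem exists_hasNormalFormAt_const [ConnectedSpace M] {g : SurfaceMetric M}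
    (h : ∀ p : M, ∃ c : ℝ, c ≠ 0 ∧ HasNormalFormAt g c p) :
    ∃ c : ℝ, c ≠ 0 ∧ ∀ p : M, HasNormalFormAt g c p := by
  choose c hc hN using h
  have hloc : IsLocallyConstant fun p => c p ^ 2 := by
    refine (IsLocallyConstant.iff_eventually_eq _).2 fun p => ?_
    obtain ⟨e, f, hp, he⟩ := hasNormalFormAt_iff.1 (hN p)
    filter_upwards [e.open_source.mem_nhds hp] with q hq
    obtain ⟨e', f', hq', he'⟩ := hasNormalFormAt_iff.1 (hN q)
    exact he'.sq_const_unique he hq' hq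
  obtain ⟨p0⟩ : Nonempty M := inferInstance
  exact ⟨c p0, hc p0, fun p =>
    hasNormalFormAt_congr_sq (hloc.apply_eq_of_preconnectedSpace p p0) (hN p)⟩

end NormalForm

/-! ### Inverse functions, primitives and new charts -/

/-- A smooth function of one variable with non-vanishing derivative has a smooth local right
inverse. -/
theorem exists_contDiffOn_rightInverse {φ φ' : ℝ → ℝ} {V : Set ℝ} {a : ℝ} (hV : IsOpen V)
    (ha : a ∈ V) (hφ : ContDiffOn ℝ ∞ φ V) (hd : ∀ y ∈ V, HasDerivAt φ (φ' y) y)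
    (h0 : ∀ y ∈ V, φ' y ≠ 0) :
    ∃ (ρ : ℝ → ℝ) (ε : ℝ), 0 < ε ∧ ContDiffOn ℝ ∞ ρ (Metric.ball (φ a) ε) ∧ ρ (φ a) = a ∧
      ∀ y ∈ Metric.ball (φ a) ε, ρ y ∈ V ∧ φ (ρ y) = y ∧ HasDerivAt ρ (φ' (ρ y))⁻¹ y := by
  have hat : ∀ y ∈ V, ContDiffAt ℝ ∞ φ y := fun y hy => hφ.contDiffAt (hV.mem_nhds hy)
  have hfd := (hd a ha).hasFDerivAt_equiv (h0 a ha)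
  set T := (hat a ha).toOpenPartialHomeomorph φ hfd (by simp) with hT
  have hTa : a ∈ T.source := (hat a ha).mem_toOpenPartialHomeomorph_source hfd (by simp)
  have hTc : ∀ y, T y = φ y := fun _ => rfl
  have hmem : φ a ∈ T.target ∩ T.symm ⁻¹' V :=
    ⟨by rw [← hTc]; exact T.map_source hTa, by
      rw [mem_preimage, ← hTc, T.left_inv hTa]; exact ha⟩
  obtain ⟨ε, hε, hball⟩ := Metric.isOpen_iff.1
    (T.symm.isOpen_inter_preimage hV) (φ a) hmem
  refine ⟨T.symm, ε, hε, fun y hy => ?_, by rw [← hTc, T.left_inv hTa], fun y hy => ?_⟩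
  · exact (T.contDiffAt_symm_deriv (h0 _ (hball hy).2) (hball hy).1 (hd _ (hball hy).2)
      (hat _ (hball hy).2)).contDiffWithinAt
  · exact ⟨(hball hy).2, T.right_inv (hball hy).1,
      T.hasDerivAt_symm (hball hy).1 (h0 _ (hball hy).2) (hd _ (hball hy).2)⟩

theorem partialDeriv_eq_of_hasFDerivAt {h : Plane → ℝ} {L : Plane →L[ℝ] ℝ} {x : Plane}
    (hh : HasFDerivAt h L x) (i : Fin 2) :
    partialDeriv i h x = L (EuclideanSpace.single i 1) := by
  rw [partialDeriv, hh.fderiv]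

/-- A closed smooth `1`-form `a dx + b dy` on a ball of the plane is the differential of a smooth
function. -/
theorem exists_primitive {a b : Plane → ℝ} {z : Plane} {r : ℝ}
    (ha : ContDiffOn ℝ ∞ a (Metric.ball z r)) (hb : ContDiffOn ℝ ∞ b (Metric.ball z r))
    (hab : ∀ x ∈ Metric.ball z r, partialDeriv 1 a x = partialDeriv 0 b x) :
    ∃ w : Plane → ℝ, ContDiffOn ℝ ∞ w (Metric.ball z r) ∧ ∀ x ∈ Metric.ball z r,
      partialDeriv 0 w x = a x ∧ partialDeriv 1 w x = b x := by
  set P : Fin 2 → Plane →L[ℝ] ℝ := fun i => EuclideanSpace.proj i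
  set θ : Plane → Plane →L[ℝ] ℝ := fun x => a x • P 0 + b x • P 1 with hθ
  have hθs : ContDiffOn ℝ ∞ θ (Metric.ball z r) :=
    (ha.smul contDiffOn_const).add (hb.smul contDiffOn_const)
  obtain ⟨w, hw⟩ := (convex_ball z r).exists_forall_hasFDerivAt_of_fderiv_symmetric
    Metric.isOpen_ball (hθs.differentiableOn (by simp)) (by
      intro x hx v w
      have hda := (differentiableAt_of_contDiffOn Metric.isOpen_ball ha hx).hasFDerivAt
      have hdb := (differentiableAt_of_contDiffOn Metric.isOpen_ball hb hx).hasFDerivAt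
      have h1 := (hda.smul_const (P 0)).add (hdb.smul_const (P 1))
      have h2 : fderiv ℝ θ x = _ := h1.fderiv
      rw [h2]
      have h3 := hab x hx
      simp [P, fderiv_eq_sum]
      linear_combination (v 1 * w 0 - v 0 * w 1) * h3)
  refine ⟨w, ?_, fun x hx => ?_⟩
  · rw [contDiffOn_infty_iff_fderiv_of_isOpen Metric.isOpen_ball]
    exact ⟨fun x hx => (hw x hx).differentiableAt.differentiableWithinAt,
      hθs.congr fun x hx => (hw x hx).fderiv⟩
  · rw [partialDeriv_eq_of_hasFDerivAt (hw x hx), partialDeriv_eq_of_hasFDerivAt (hw x hx)]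
    simp [hθ, P]

theorem contDiffOn_jac_det {Φ : Plane → Plane} {V : Set Plane} (hV : IsOpen V)
    (hΦ : ContDiffOn ℝ ∞ Φ V) : ContDiffOn ℝ ∞ (fun x => (jac Φ x).det) V := by
  have h1 : ∀ a i, ContDiffOn ℝ ∞ (fun x => jac Φ x a i) V := fun a i =>
    contDiffOn_partialDeriv hV (contDiffOn_euclidean.1 hΦ a) i
  simp only [Matrix.det_fin_two]
  exact ((h1 0 0).mul (h1 1 1)).sub ((h1 0 1).mul (h1 1 0))

section NewChart

variable {M : Type*} [TopologicalSpace M] [ChartedSpace Plane M] [IsManifold (𝓡 2) ∞ M]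
  {e : OpenPartialHomeomorph M Plane}

/-- A smooth map with positive Jacobian determinant, composed with a positively oriented chart,
restricts to a positively oriented chart around the point, whose target may be taken to be a
ball. -/
theorem exists_chart_comp (he : IsPositiveChart e) {p : M} (hp : p ∈ e.source)
    {Φ : Plane → Plane} {V : Set Plane} (hV : IsOpen V) (hpV : e p ∈ V)
    (hΦ : ContDiffOn ℝ ∞ Φ V) (hdet : 0 < (jac Φ (e p)).det) :
    ∃ (e' : OpenPartialHomeomorph M Plane) (r : ℝ), 0 < r ∧ IsPositiveChart e' ∧
      p ∈ e'.source ∧ e'.target = Metric.ball (Φ (e p)) r ∧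
      ∀ q ∈ e'.source, q ∈ e.source ∧ e q ∈ V ∧ 0 < (jac Φ (e q)).det ∧ e' q = Φ (e q) := by
  have hat : ∀ x ∈ V, ContDiffAt ℝ ∞ Φ x := fun x hx => hΦ.contDiffAt (hV.mem_nhds hx)
  have hd : ∀ x ∈ V, DifferentiableAt ℝ Φ x := fun x hx => (hat x hx).differentiableAt (by simp)
  have hfd : ∀ x (hx : x ∈ V) (h0 : 0 < (jac Φ x).det), HasFDerivAt Φ
      (((fderiv ℝ Φ x).toContinuousLinearEquivOfDetNeZero
        (by rw [det_fderiv_eq_jac (hd x hx)]; exact h0.ne') : Plane ≃L[ℝ] Plane) :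
        Plane →L[ℝ] Plane) x := by
    intro x hx h0
    rw [ContinuousLinearMap.coe_toContinuousLinearEquivOfDetNeZero]
    exact (hd x hx).hasFDerivAt
  set T := (hat _ hpV).toOpenPartialHomeomorph Φ (hfd _ hpV hdet) (by simp) with hT
  have hTs : e p ∈ T.source :=
    (hat _ hpV).mem_toOpenPartialHomeomorph_source (hfd _ hpV hdet) (by simp)
  have hTc : ∀ y, T y = Φ y := fun _ => rfl
  set V' : Set Plane := V ∩ (fun x => (jac Φ x).det) ⁻¹' Ioi 0 with hV'
  have hV'o : IsOpen V' :=
    (contDiffOn_jac_det hV hΦ).continuousOn.isOpen_inter_preimage hV isOpen_Ioi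
  set E := e ≫ₕ T.restrOpen V' hV'o with hE
  have hEs : ∀ q ∈ E.source, q ∈ e.source ∧ e q ∈ T.source ∧ e q ∈ V' := by
    intro q hq
    simp only [hE, OpenPartialHomeomorph.trans_source, OpenPartialHomeomorph.restrOpen_source] at hq
    exact ⟨hq.1, hq.2.1, hq.2.2⟩
  have hpE : p ∈ E.source := by
    simp only [hE, OpenPartialHomeomorph.trans_source, OpenPartialHomeomorph.restrOpen_source]
    exact ⟨hp, hTs, hpV, hdet⟩
  have hEc : ∀ q, E q = Φ (e q) := fun _ => rfl
  obtain ⟨r, hr, hball⟩ := Metric.isOpen_iff.1 E.open_target (E p) (E.map_source hpE)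
  set e' := (E.symm.restrOpen (Metric.ball (E p) r) Metric.isOpen_ball).symm with he'
  have ht : e'.target = Metric.ball (E p) r := by
    change E.target ∩ Metric.ball (E p) r = _
    exact inter_eq_right.2 hball
  have hec : ∀ q, e' q = Φ (e q) := fun _ => rfl
  have hsymm : ∀ x, e'.symm x = E.symm x := fun _ => rfl
  have hss : ∀ q ∈ e'.source, q ∈ E.source := by
    intro q hq
    have h1 := e'.map_source hq
    rw [ht] at h1
    rw [← e'.left_inv hq, hsymm]
    exact E.map_target (hball h1)
  have hps : p ∈ e'.source := by
    have : E p ∈ e'.target := by rw [ht]; exact Metric.mem_ball_self hr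
    have h2 := e'.map_target this
    rwa [hsymm, E.left_inv hpE] at h2
  have hprop : ∀ q ∈ e'.source,
      q ∈ e.source ∧ e q ∈ V ∧ 0 < (jac Φ (e q)).det ∧ e' q = Φ (e q) := fun q hq =>
    ⟨(hEs q (hss q hq)).1, (hEs q (hss q hq)).2.2.1, (hEs q (hss q hq)).2.2.2, hec q⟩
  have hmax : e' ∈ IsManifold.maximalAtlas (𝓡 2) ∞ M := by
    rw [IsManifold.mem_maximalAtlas_iff_contMDiffOn]
    constructor
    · have h1 := (contMDiffOn_of_mem_maximalAtlas he.1).mono (fun q hq => (hprop q hq).1)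
      exact hΦ.contMDiffOn.comp h1 fun q hq => (hprop q hq).2.1
    · have h1 := contMDiffOn_symm_of_mem_maximalAtlas he.1
      have hx : ∀ x ∈ e'.target, x ∈ T.target ∧ T.symm x ∈ V' ∧ T.symm x ∈ e.target := by
        intro x hx
        rw [ht] at hx
        have h2 := hball hx
        rw [hE, OpenPartialHomeomorph.trans_target] at h2
        exact ⟨h2.1.1, h2.1.2, h2.2⟩
      have h2 : ContDiffOn ℝ ∞ T.symm e'.target := fun x hx' =>
        (T.contDiffAt_symm (hx x hx').1 (hfd _ (hx x hx').2.1.1 (hx x hx').2.1.2)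
          (hat _ (hx x hx').2.1.1)).contDiffWithinAt
      exact h1.comp h2.contMDiffOn fun x hx' => (hx x hx').2.2
  refine ⟨e', r, hr, ⟨hmax, fun ea hea x hx => ?_⟩, hps, ht, hprop⟩
  have hea' := IsManifold.subset_maximalAtlas (I := 𝓡 2) (n := ∞) hea
  have hx1 : x ∈ e'.target := hx.1
  have hx2 : e'.symm x ∈ ea.source := hx.2
  obtain ⟨hq1, hq2, hq3, hq4⟩ := hprop _ (e'.map_target hx1)
  set q := e'.symm x with hq
  have hxq : Φ (e q) = x := by rw [← hq4, hq, e'.right_inv hx1]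
  have hdt := transition_diffAt hmax hea' hx
  have hov := mem_overlap hq1 hx2
  have hev : transition e ea =ᶠ[nhds (e q)] fun y => transition e' ea (Φ y) := by
    filter_upwards [(e.isOpen_inter_preimage_symm e'.open_source).mem_nhds
      (show e q ∈ e.target ∩ e.symm ⁻¹' e'.source from
        ⟨e.map_source hq1, by rw [mem_preimage, e.left_inv hq1]; exact e'.map_target hx1⟩)]
      with y hy
    have h1 := hec (e.symm y)
    rw [e.right_inv hy.1] at h1
    rw [transition, transition, ← h1, e'.left_inv hy.2]
  have h1 := he.2 ea hea (e q) hov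
  have h2 : fderiv ℝ (e.symm ≫ₕ ea) (e q) = fderiv ℝ (transition e ea) (e q) := rfl
  have h3 : fderiv ℝ (e'.symm ≫ₕ ea) x = fderiv ℝ (transition e' ea) x := rfl
  rw [h2, det_fderiv_eq_jac (transition_diffAt he.1 hea' hov)] at h1
  rw [h3, det_fderiv_eq_jac hdt]
  have h4 : jac (transition e ea) (e q) = jac (transition e' ea) x * jac Φ (e q) := by
    rw [← hxq, ← jac_comp (by rw [hxq]; exact hdt) (hd _ hq2)]
    ext a i
    exact partialDeriv_congr i (hev.fun_comp fun v => v a)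
  rw [h4, Matrix.det_mul] at h1
  exact (mul_pos_iff_of_pos_right hq3).1 h1

end NewChart

/-! ### Charts adapted to the level curves -/

section Adapted

variable {M : Type*} [TopologicalSpace M] [ChartedSpace Plane M] [IsManifold (𝓡 2) ∞ M]

/-- A positively oriented chart whose first coordinate is the positive root `x` of
`1 + K + 3 x² + c² x³ = 0`. -/
structure IsAdaptedChart (g : SurfaceMetric M) (c : ℝ) (e : OpenPartialHomeomorph M Plane) :
    Prop where
  positive : IsPositiveChart e
  root : ∀ q ∈ e.source, IsUniquePositiveRoot c (gaussianCurvature g q) (e q 0)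

/-- The positive root of `1 + K + 3 y² + c² y³ = 0` depends smoothly on the point: it is a smooth
inverse function of `y ↦ -1 - 3 y² - c² y³` applied to `K`. -/
theorem contDiffOn_root {g : SurfaceMetric M} {c : ℝ} {F : M → ℝ}
    (hF : ∀ p, IsUniquePositiveRoot c (gaussianCurvature g p) (F p))
    {e : OpenPartialHomeomorph M Plane} (he : IsPositiveChart e) :
    ContDiffOn ℝ ∞ (fun x => F (e.symm x)) e.target := by
  intro x hx
  have hK := (contDiffOn_gaussianCurvature_symm g he.1).contDiffAt (e.open_target.mem_nhds hx)
  set P : ℝ → ℝ := fun y => -1 - 3 * y ^ 2 - c ^ 2 * y ^ 3 with hP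
  have hPs : ContDiff ℝ ∞ P := by fun_prop
  have hPd : ∀ y ∈ Ioi (0 : ℝ), HasDerivAt P (-(6 * y + 3 * c ^ 2 * y ^ 2)) y :=
    fun y _ => hasDerivAt_curvaturePoly c y
  have hP0 : ∀ y ∈ Ioi (0 : ℝ), -(6 * y + 3 * c ^ 2 * y ^ 2) ≠ 0 := by
    intro y hy
    have : 0 < y := hy
    have : 0 < 6 * y + 3 * c ^ 2 * y ^ 2 := by positivity
    linarith
  obtain ⟨ρ, ε, hε, hρs, -, hρ⟩ := exists_contDiffOn_rightInverse isOpen_Ioi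
    (show F (e.symm x) ∈ Ioi (0 : ℝ) from (hF _).1.1) hPs.contDiffOn hPd hP0
  have hPF : P (F (e.symm x)) = gaussianCurvature g (e.symm x) := by
    have := (hF (e.symm x)).1.2
    simp only [hP]; linarith
  rw [hPF] at hρs hρ
  have hball : Metric.ball (gaussianCurvature g (e.symm x)) ε
    ∈ nhds (gaussianCurvature g (e.symm x)) := Metric.ball_mem_nhds _ hε
  have h1 : ContDiffAt ℝ ∞ (fun y => ρ (gaussianCurvature g (e.symm y))) x :=
    (hρs.contDiffAt hball).comp x hK
  refine (h1.congr_of_eventuallyEq ?_).contDiffWithinAt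
  filter_upwards [hK.continuousAt.preimage_mem_nhds hball] with y hy
  obtain ⟨h2, h3, -⟩ := hρ _ hy
  refine ((hF (e.symm y)).2 _ h2 ?_).symm
  simp only [hP] at h3
  linarith

/-- Around every point there is an adapted chart whose target is a ball. -/
theorem exists_isAdaptedChart (hM : IsOrientedAtlas M) {g : SurfaceMetric M} {c : ℝ} {F : M → ℝ}
    (hF : ∀ p, IsUniquePositiveRoot c (gaussianCurvature g p) (F p))
    (hgrad : ∀ p, gradient g (gaussianCurvature g) p ≠ 0) (p : M) :
    ∃ (e : OpenPartialHomeomorph M Plane) (r : ℝ), 0 < r ∧ IsAdaptedChart g c e ∧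
      p ∈ e.source ∧ e.target = Metric.ball (e p) r := by
  set e := chartAt Plane p
  have he : IsPositiveChart e := isPositiveChart_chartAt hM p
  have hp : p ∈ e.source := mem_chart_source Plane p
  have hx := e.map_source hp
  have hFs := contDiffOn_root hF he
  set A : ℝ := partialDeriv 0 (fun x => F (e.symm x)) (e p) with hA
  set B : ℝ := partialDeriv 1 (fun x => F (e.symm x)) (e p) with hB
  have hFd := differentiableAt_of_contDiffOn e.open_target hFs hx
  have hKd := differentiableAt_of_contDiffOn e.open_target
    (contDiffOn_gaussianCurvature_symm g he.1) hx
  -- The differential of the root vanishes only where that of `K` does.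
  have hAB : 0 < A * A + B * B := by
    by_contra hneg
    have hA0 : A = 0 := by nlinarith
    have hB0 : B = 0 := by nlinarith
    have hdF : fderiv ℝ (fun x => F (e.symm x)) (e p) = 0 := by
      ext w
      rw [fderiv_eq_sum, Fin.sum_univ_two, ← hA, ← hB, hA0, hB0]
      simp
    have hdF' : HasFDerivAt (fun x => F (e.symm x)) (0 : Plane →L[ℝ] ℝ) (e p) := by
      rw [← hdF]; exact hFd.hasFDerivAt
    have hdK : HasFDerivAt (fun x => gaussianCurvature g (e.symm x)) (0 : Plane →L[ℝ] ℝ) (e p) := by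
      have h1 := (hasDerivAt_curvaturePoly c (F (e.symm (e p)))).comp_hasFDerivAt (e p) hdF'
      rw [smul_zero] at h1
      refine h1.congr_of_eventuallyEq (Filter.Eventually.of_forall fun x => ?_)
      have := (hF (e.symm x)).1.2
      simp only [Function.comp]
      linarith
    have h2 : ∀ z : TangentSpace (𝓡 2) p, mfderiv (𝓡 2) 𝓘(ℝ, ℝ) (gaussianCurvature g) p z
        = (0 : ℝ) := by
      intro z
      rw [mfderiv_eq_sum he.1 hp hKd]
      simp only [partialDeriv, hdK.fderiv, _root_.zero_apply, mul_zero,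
        Finset.sum_const_zero]
      rfl
    have h3 := gradient_spec g (gaussianCurvature g) p (gradient g (gaussianCurvature g) p)
    rw [h2] at h3
    exact (g.pos p _ (hgrad p)).ne' h3
  -- With this linear second component the Jacobian determinant at the point is `A² + B²`.
  set Φ : Plane → Plane := fun x => !₂[F (e.symm x), -B * x 0 + A * x 1] with hΦ
  have hcoord : ∀ i, ContDiff ℝ ∞ (fun x : Plane => x i) := fun i =>
    (EuclideanSpace.proj i : Plane →L[ℝ] ℝ).contDiff
  have hΦs : ContDiffOn ℝ ∞ Φ e.target := by
    rw [contDiffOn_euclidean]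
    intro i
    fin_cases i
    · simpa [hΦ] using hFs
    · exact ((contDiff_const.mul (hcoord 0)).add (contDiff_const.mul (hcoord 1))).contDiffOn
  have hlin : ∀ i, partialDeriv i (fun x : Plane => -B * x 0 + A * x 1) (e p)
      = if i = 0 then -B else A := by
    intro i
    have h1 : HasFDerivAt (fun x : Plane => -B * x 0 + A * x 1)
        ((-B) • (EuclideanSpace.proj (0 : Fin 2) : Plane →L[ℝ] ℝ)
          + A • (EuclideanSpace.proj (1 : Fin 2) : Plane →L[ℝ] ℝ)) (e p) :=
      ((EuclideanSpace.proj (0 : Fin 2) : Plane →L[ℝ] ℝ).hasFDerivAt.const_mul (-B)).add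
        ((EuclideanSpace.proj (1 : Fin 2) : Plane →L[ℝ] ℝ).hasFDerivAt.const_mul A)
    rw [partialDeriv_eq_of_hasFDerivAt h1]
    fin_cases i <;> simp
  have hdet : 0 < (jac Φ (e p)).det := by
    have h1 : (jac Φ (e p)).det = A * A + B * B := by
      rw [Matrix.det_fin_two]
      simp only [jac, Matrix.of_apply]
      have h0 : (fun y => Φ y 0) = fun x => F (e.symm x) := by ext; simp [hΦ]
      have h1 : (fun y => Φ y 1) = fun x : Plane => -B * x 0 + A * x 1 := by ext; simp [hΦ]
      rw [h0, h1, hlin, hlin, ← hA, ← hB]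
      simp
    rw [h1]; exact hAB
  obtain ⟨e', r, hr, he', hpe', ht, hprop⟩ :=
    exists_chart_comp he hp e.open_target hx hΦs hdet
  refine ⟨e', r, hr, ⟨he', fun q hq => ?_⟩, hpe', ?_⟩
  · obtain ⟨h1, -, -, h2⟩ := hprop q hq
    have h3 : e' q 0 = F q := by rw [h2]; simp [hΦ, h1]
    rw [h3]; exact hF q
  · rw [ht, (hprop p hpe').2.2.2]

namespace IsAdaptedChart

variable {g : SurfaceMetric M} {c : ℝ} {e : OpenPartialHomeomorph M Plane}

theorem pos (h : IsAdaptedChart g c e) {x : Plane} (hx : x ∈ e.target) : 0 < x 0 := by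
  have := (h.root _ (e.map_target hx)).1.1
  rwa [e.right_inv hx] at this

theorem curvature_eq (h : IsAdaptedChart g c e) {x : Plane} (hx : x ∈ e.target) :
    gaussianCurvature g (e.symm x) = -1 - 3 * x 0 ^ 2 - c ^ 2 * x 0 ^ 3 := by
  have := (h.root _ (e.map_target hx)).1.2
  rw [e.right_inv hx] at this
  linarith

theorem partialDeriv_curvature (h : IsAdaptedChart g c e) {x : Plane} (hx : x ∈ e.target)
    (i : Fin 2) : partialDeriv i (fun x => gaussianCurvature g (e.symm x)) x
      = if i = 0 then -(6 * x 0 + 3 * c ^ 2 * x 0 ^ 2) else 0 := by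
  have hev : (fun x => gaussianCurvature g (e.symm x)) =ᶠ[nhds x]
      fun x => -1 - 3 * x 0 ^ 2 - c ^ 2 * x 0 ^ 3 := by
    filter_upwards [e.open_target.mem_nhds hx] with y hy using h.curvature_eq hy
  rw [partialDeriv_congr i hev]
  exact partialDeriv_comp_fst (hasDerivAt_curvaturePoly c (x 0)) i

/-- The coefficient `g⁰⁰ = |dx|²` of the inverse metric. -/
def invCoeff (g : SurfaceMetric M) (e : OpenPartialHomeomorph M Plane) (x : Plane) : ℝ :=
  metricCoeff g e x 1 1 / (metricCoeff g e x).det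

theorem metric_smooth (h : IsAdaptedChart g c e) : SmoothMetricOn (metricCoeff g e) e.target :=
  smoothMetricOn_metricCoeff g h.positive.1

theorem invCoeff_pos (h : IsAdaptedChart g c e) {x : Plane} (hx : x ∈ e.target) :
    0 < invCoeff g e x :=
  div_pos (h.metric_smooth.pos x hx).2 (h.metric_smooth.det_pos x hx)

theorem invCoeff_contDiffOn (h : IsAdaptedChart g c e) :
    ContDiffOn ℝ ∞ (invCoeff g e) e.target := by
  refine (h.metric_smooth.smooth 1 1).div ?_ fun x hx => (h.metric_smooth.det_pos x hx).ne'
  have hs := h.metric_smooth.smooth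
  simp only [Matrix.det_fin_two]
  exact ((hs 0 0).mul (hs 1 1)).sub ((hs 0 1).mul (hs 1 0))

theorem offDiag_symm (_ : IsAdaptedChart g c e) (x : Plane) :
    metricCoeff g e x 1 0 = metricCoeff g e x 0 1 :=
  congrFun (congrFun (metricCoeff_symm g e x) 0) 1

theorem vecCoord_gradient (h : IsAdaptedChart g c e) {x : Plane} (hx : x ∈ e.target) :
    vecCoord e (e.symm x) (gradient g (gaussianCurvature g) (e.symm x)) 0
      = -(6 * x 0 + 3 * c ^ 2 * x 0 ^ 2) * invCoeff g e x ∧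
    vecCoord e (e.symm x) (gradient g (gaussianCurvature g) (e.symm x)) 1
      = (6 * x 0 + 3 * c ^ 2 * x 0 ^ 2) * (metricCoeff g e x 0 1 / (metricCoeff g e x).det) := by
  have hKd := differentiableAt_of_contDiffOn e.open_target
    (contDiffOn_gaussianCurvature_symm g h.positive.1) hx
  have h0 := metricCoeff_mul_gradient g h.positive.1 (e.map_target hx)
    (h := gaussianCurvature g) (by rwa [e.right_inv hx])
  simp only [e.right_inv hx, h.partialDeriv_curvature hx, Fin.sum_univ_two] at h0
  have h1 := h0 0
  have h2 := h0 1
  have hD := (h.metric_smooth.det_pos x hx).ne'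
  have hD' := Matrix.det_fin_two (metricCoeff g e x)
  rw [h.offDiag_symm] at hD' h2
  simp only [if_true, one_ne_zero, if_false] at h1 h2
  unfold invCoeff
  constructor <;> rw [← mul_div_assoc, eq_div_iff hD, hD']
  · linear_combination metricCoeff g e x 1 1 * h1 - metricCoeff g e x 0 1 * h2
  · linear_combination metricCoeff g e x 0 0 * h2 - metricCoeff g e x 0 1 * h1

theorem vecNorm_gradient (h : IsAdaptedChart g c e) {x : Plane} (hx : x ∈ e.target) :
    vecNorm g (gradient g (gaussianCurvature g) (e.symm x))
      = (6 * x 0 + 3 * c ^ 2 * x 0 ^ 2) * Real.sqrt (invCoeff g e x) := by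
  have hq := (h.invCoeff_pos hx).le
  have hx0 := h.pos hx
  have hD := (h.metric_smooth.det_pos x hx).ne'
  have hD' := Matrix.det_fin_two (metricCoeff g e x)
  rw [h.offDiag_symm] at hD'
  have h1 : g.inner (e.symm x) (gradient g (gaussianCurvature g) (e.symm x))
      (gradient g (gaussianCurvature g) (e.symm x))
      = ((6 * x 0 + 3 * c ^ 2 * x 0 ^ 2) * Real.sqrt (invCoeff g e x)) ^ 2 := by
    rw [inner_eq g h.positive.1 (e.map_target hx), mul_pow, Real.sq_sqrt hq]
    simp only [Fin.sum_univ_two, e.right_inv hx, h.vecCoord_gradient hx, h.offDiag_symm]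
    unfold invCoeff
    field_simp
    rw [hD']
    ring
  rw [vecNorm, h1, Real.sqrt_sq (by positivity)]

/-- Through every point of an adapted chart there is a level curve of `K`, namely the coordinate
line `x = const`, traversed at unit speed. -/
theorem exists_levelCurve (h : IsAdaptedChart g c e) {x : Plane} (hx : x ∈ e.target) :
    ∃ (γ : ℝ → M) (ε : ℝ), 0 < ε ∧ γ 0 = e.symm x ∧
      IsLevelCurveOn g (gaussianCurvature g) γ (-ε) ε ∧
      ∀ t ∈ Ioo (-ε) ε, γ t ∈ e.source ∧ e (γ t) 0 = x 0 ∧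
        vecCoord e (γ t) (velocity γ t) 0 = 0 ∧
        vecCoord e (γ t) (velocity γ t) 1
          = -(Real.sqrt (metricCoeff g e (e (γ t)) 1 1))⁻¹ := by
  set ℓ : ℝ → Plane := fun y => x + (y - x 1) • EuclideanSpace.single 1 (1 : ℝ) with hℓ
  have hℓs : ContDiff ℝ ∞ ℓ :=
    contDiff_const.add ((contDiff_id.sub contDiff_const).smul contDiff_const)
  have hℓ0 : ∀ y, ℓ y 0 = x 0 := by intro y; simp [hℓ]
  have hℓ1 : ∀ y, ℓ y 1 = y := by intro y; simp [hℓ]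
  have hℓx : ℓ (x 1) = x := by simp [hℓ]
  obtain ⟨δ, hδ, hball⟩ : ∃ δ > 0, Metric.ball (x 1) δ ⊆ ℓ ⁻¹' e.target :=
    Metric.mem_nhds_iff.1 (hℓs.continuous.continuousAt.preimage_mem_nhds
      (e.open_target.mem_nhds (by rwa [hℓx])))
  have hHpos : ∀ y ∈ Metric.ball (x 1) δ, 0 < metricCoeff g e (ℓ y) 1 1 := fun y hy =>
    (h.metric_smooth.pos _ (hball hy)).2
  -- The sign makes `(grad K, γ')` positively oriented, as `grad K` points to decreasing `x`.
  set σ : ℝ → ℝ := fun y => -Real.sqrt (metricCoeff g e (ℓ y) 1 1) with hσ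
  have hσs : ContDiffOn ℝ ∞ σ (Metric.ball (x 1) δ) :=
    (((h.metric_smooth.smooth 1 1).comp hℓs.contDiffOn hball).sqrt
      fun y hy => (hHpos y hy).ne').neg
  -- `s` is minus the arc length along the coordinate line.
  obtain ⟨s, hs⟩ := (convex_ball (x 1) δ).exists_forall_hasDerivWithinAt
    (hσs.differentiableOn (by simp))
  have hsd : ∀ y ∈ Metric.ball (x 1) δ, HasDerivAt s (σ y) y := fun y hy =>
    (hs y hy).hasDerivAt (Metric.isOpen_ball.mem_nhds hy)
  have hss : ContDiffOn ℝ ∞ s (Metric.ball (x 1) δ) := by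
    rw [contDiffOn_infty_iff_deriv_of_isOpen Metric.isOpen_ball]
    exact ⟨fun y hy => (hsd y hy).differentiableAt.differentiableWithinAt,
      hσs.congr fun y hy => (hsd y hy).deriv⟩
  have hσ0 : ∀ y ∈ Metric.ball (x 1) δ, σ y ≠ 0 := fun y hy =>
    neg_ne_zero.2 (Real.sqrt_pos.2 (hHpos y hy)).ne'
  obtain ⟨ρ, ε, hε, hρs, hρ0, hρ⟩ := exists_contDiffOn_rightInverse Metric.isOpen_ball
    (Metric.mem_ball_self hδ) hss hsd hσ0
  have hIoo : ∀ t ∈ Ioo (-ε) ε, s (x 1) + t ∈ Metric.ball (s (x 1)) ε := by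
    intro t ht
    rw [Metric.mem_ball, Real.dist_eq, add_sub_cancel_left]
    exact abs_lt.2 ht
  set y : ℝ → ℝ := fun t => ρ (s (x 1) + t) with hy
  have hyb : ∀ t ∈ Ioo (-ε) ε, y t ∈ Metric.ball (x 1) δ := fun t ht => (hρ _ (hIoo t ht)).1
  have hys : ContDiffOn ℝ ∞ y (Ioo (-ε) ε) :=
    hρs.comp (contDiff_const.add contDiff_id).contDiffOn hIoo
  have hyd : ∀ t ∈ Ioo (-ε) ε, HasDerivAt y (σ (y t))⁻¹ t := fun t ht =>
    (hρ _ (hIoo t ht)).2.2.comp_const_add (s (x 1)) t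
  have hmem : ∀ t ∈ Ioo (-ε) ε, ℓ (y t) ∈ e.target := fun t ht => hball (hyb t ht)
  have hsm : ContMDiffOn 𝓘(ℝ, ℝ) (𝓡 2) ∞ (fun t => e.symm (ℓ (y t))) (Ioo (-ε) ε) :=
    (contMDiffOn_symm_of_mem_maximalAtlas h.positive.1).comp
      (hℓs.comp_contDiffOn hys).contMDiffOn hmem
  have hvel : ∀ t ∈ Ioo (-ε) ε,
      vecCoord e (e.symm (ℓ (y t))) (velocity (fun t => e.symm (ℓ (y t))) t) 0 = 0 ∧
      vecCoord e (e.symm (ℓ (y t))) (velocity (fun t => e.symm (ℓ (y t))) t) 1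
        = -(Real.sqrt (metricCoeff g e (ℓ (y t)) 1 1))⁻¹ := by
    intro t ht
    have hv := vecCoord_velocity h.positive.1 (e.map_target (hmem t ht))
      (mdifferentiableAt_curve hsm ht)
    have hev : ∀ᶠ s in nhds t, e (e.symm (ℓ (y s))) = ℓ (y s) := by
      filter_upwards [isOpen_Ioo.mem_nhds ht] with s hs using e.right_inv (hmem s hs)
    constructor
    · refine (hv 0).unique ((hasDerivAt_const t (x 0)).congr_of_eventuallyEq ?_)
      filter_upwards [hev] with s hs
      rw [hs, hℓ0]
    · have h1 := (hv 1).unique ((hyd t ht).congr_of_eventuallyEq (by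
        filter_upwards [hev] with s hs
        rw [hs, hℓ1]))
      rw [h1, hσ, inv_neg]
  have hγ0 : e.symm (ℓ (y 0)) = e.symm x := by
    have : y 0 = x 1 := by rw [hy]; simp [hρ0]
    rw [this, hℓx]
  refine ⟨fun t => e.symm (ℓ (y t)), ε, hε, hγ0, ⟨by linarith, hsm, ?_, ?_, ?_⟩, fun t ht => ?_⟩
  · refine ⟨-1 - 3 * x 0 ^ 2 - c ^ 2 * x 0 ^ 3, fun t ht => ?_⟩
    rw [h.curvature_eq (hmem t ht), hℓ0]
  · intro t ht
    have hH := hHpos _ (hyb t ht)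
    rw [vecNorm, inner_eq g h.positive.1 (e.map_target (hmem t ht)), Real.sqrt_eq_one]
    simp only [Fin.sum_univ_two, (hvel t ht).1, (hvel t ht).2, e.right_inv (hmem t ht)]
    simp only [mul_zero, zero_mul, zero_add]
    rw [mul_assoc, neg_mul_neg, ← mul_inv, Real.mul_self_sqrt hH.le, mul_inv_cancel₀ hH.ne']
  · intro t ht
    have hH := Real.sqrt_pos.2 (hHpos _ (hyb t ht))
    have hx0 := h.pos (hmem t ht)
    have hq := h.invCoeff_pos (hmem t ht)
    rw [isPositivePair_iff h.positive (e.map_target (hmem t ht)), (hvel t ht).1, (hvel t ht).2,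
      (h.vecCoord_gradient (hmem t ht)).1, mul_zero, sub_zero, neg_mul, neg_mul_neg]
    positivity
  · simp only
    rw [e.right_inv (hmem t ht)]
    exact ⟨e.map_target (hmem t ht), hℓ0 _, hvel t ht⟩

/-- The consequences of the circle condition in an adapted chart: `|dx|²` is a function of `x`
alone, and `Γ⁰₁₁` is determined. -/
theorem circle_consequences (h : IsAdaptedChart g c e) (hB : HasCircularLevelCurves g c)
    {x : Plane} (hx : x ∈ e.target) :
    partialDeriv 1 (invCoeff g e) x = 0 ∧
    christoffel (metricCoeff g e) 0 1 1 x
      = 3 / 4 * invCoeff g e x * metricCoeff g e x 1 1 / x 0 := by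
  obtain ⟨-, -, F, hF, hcirc⟩ := hB
  obtain ⟨γ, ε, hε, hγ0, hlev, hγ⟩ := h.exists_levelCurve hx
  obtain ⟨κ, hκ0, ⟨N, hN⟩, hκ⟩ := hcirc γ (-ε) ε hlev
  have h0 : (0 : ℝ) ∈ Ioo (-ε) ε := ⟨by linarith, hε⟩
  have hmd := mdifferentiableAt_curve hlev.smooth h0
  have hxt : e (γ 0) = x := by rw [hγ0, e.right_inv hx]
  have hx0 := h.pos hx
  have hκt : ∀ t ∈ Ioo (-ε) ε, κ = 3 / 4 * Real.sqrt (invCoeff g e (e (γ t))) / x 0 := by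
    intro t ht
    obtain ⟨hs, ht0, -, -⟩ := hγ t ht
    have hxt := e.map_source hs
    have hFt : F (γ t) = e (γ t) 0 :=
      ((h.root _ hs).2 _ (hF _).1.1 (hF _).1.2)
    have hn := h.vecNorm_gradient hxt
    have hK := h.curvature_eq hxt
    rw [e.left_inv hs] at hn hK
    rw [hκ t ht, hn, hK, hFt, ht0]
    have h1 : -1 - 3 * x 0 ^ 2 - c ^ 2 * x 0 ^ 3 + x 0 ^ 2 + 1
        = -(x 0 ^ 2 * (2 + c ^ 2 * x 0)) := by ring
    have h2 : (2 + c ^ 2 * x 0) ≠ 0 := by positivity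
    rw [h1]
    field_simp
    ring
  have hqpos := h.invCoeff_pos hx
  have hHpos := (h.metric_smooth.pos x hx).2
  have hsH := Real.sqrt_pos.2 hHpos
  have hv := vecCoord_velocity h.positive.1 (hγ 0 h0).1 hmd
  have hv0 := (hγ 0 h0).2.2.1
  have hv1 := (hγ 0 h0).2.2.2
  rw [hxt] at hv1
  constructor
  -- Along the curve `κ = (3/4) |dx| / x` and `x` are constant, hence so is `|dx|²`.
  · have hd : HasDerivAt (fun t => invCoeff g e (e (γ t))) _ 0 :=
      hasDerivAt_comp_plane (c := fun t => e (γ t)) (h := invCoeff g e)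
        (differentiableAt_of_contDiffOn e.open_target h.invCoeff_contDiffOn (by rwa [hxt])) hv
    have hc : HasDerivAt (fun t => invCoeff g e (e (γ t))) 0 0 := by
      refine (hasDerivAt_const 0 ((4 / 3 * κ * x 0) ^ 2)).congr_of_eventuallyEq ?_
      filter_upwards [isOpen_Ioo.mem_nhds h0] with t ht
      have hq := h.invCoeff_pos (e.map_source (hγ t ht).1)
      have h1 : 4 / 3 * κ * x 0 = Real.sqrt (invCoeff g e (e (γ t))) := by
        rw [hκt t ht]; field_simp
      rw [h1, Real.sq_sqrt hq.le]
    have h1 := hd.unique hc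
    rw [Fin.sum_univ_two, hv0, hv1, hxt, mul_zero, zero_add] at h1
    exact (mul_eq_zero.1 h1).resolve_right (neg_ne_zero.2 (inv_ne_zero hsH.ne'))
  · obtain ⟨-, hN1, hN2, hN3, hN4, -⟩ := hN 0 h0
    have hV0 : HasDerivAt (fun s => vecCoord e (γ s) (velocity γ s) 0) 0 0 :=
      (hasDerivAt_const 0 0).congr_of_eventuallyEq (by
        filter_upwards [isOpen_Ioo.mem_nhds h0] with s hs using (hγ s hs).2.2.1)
    have hV1 : DifferentiableAt ℝ (fun s => vecCoord e (γ s) (velocity γ s) 1) 0 := by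
      have h1 : DifferentiableAt ℝ (fun s => metricCoeff g e (e (γ s)) 1 1) 0 :=
        (hasDerivAt_comp_plane (c := fun t => e (γ t)) (h := fun x => metricCoeff g e x 1 1)
          (h.metric_smooth.matDiffAt (by rwa [hxt]) 1 1) hv).differentiableAt
      have h2 : DifferentiableAt ℝ
          (fun s => -(Real.sqrt (metricCoeff g e (e (γ s)) 1 1))⁻¹) 0 :=
        ((h1.sqrt (by rw [hxt]; exact hHpos.ne')).inv (by rw [hxt]; exact hsH.ne')).neg
      refine h2.congr_of_eventuallyEq ?_
      filter_upwards [isOpen_Ioo.mem_nhds h0] with s hs using (hγ s hs).2.2.2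
    have hcov := vecCoord_covDerivAlong g h.positive.1 (hγ 0 h0).1 hmd (V := velocity γ) (by
      intro k; fin_cases k; exacts [hV0.differentiableAt, hV1]) 0
    rw [hN4, vecCoord_smul] at hcov
    simp only [covCoord, (hv _).deriv, Fin.sum_univ_two, hV0.deriv, hv0, hv1, hxt] at hcov
    simp only [mul_zero, zero_mul, zero_add, PiLp.smul_apply, smul_eq_mul] at hcov
    -- The unit normal is the unit vector in the direction of `grad x`.
    rw [vecNorm, inner_eq g h.positive.1 (hγ 0 h0).1, Real.sqrt_eq_one] at hN1
    rw [inner_eq g h.positive.1 (hγ 0 h0).1] at hN2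
    rw [isPositivePair_iff h.positive (hγ 0 h0).1] at hN3
    simp only [Fin.sum_univ_two, hv0, hv1, hxt, h.offDiag_symm] at hN1 hN2 hN3
    set n0 := vecCoord e (γ 0) (N 0) 0
    set n1 := vecCoord e (γ 0) (N 0) 1
    have hκ1 := hκt 0 h0
    rw [hxt] at hκ1
    have hD' := Matrix.det_fin_two (metricCoeff g e x)
    rw [h.offDiag_symm] at hD'
    have hDpos := h.metric_smooth.det_pos x hx
    set E := metricCoeff g e x 0 0
    set b := metricCoeff g e x 0 1
    set H := metricCoeff g e x 1 1
    set S := Real.sqrt H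
    have hSS : S⁻¹ * S⁻¹ = H⁻¹ := by rw [← mul_inv, Real.mul_self_sqrt hHpos.le]
    have hSi : 0 < S⁻¹ := inv_pos.2 hsH
    have hn0 : 0 < n0 := by
      have h1 : 0 < S⁻¹ * n0 := by linarith
      exact (mul_pos_iff_of_pos_left hSi).1 h1
    have hort : b * n0 + H * n1 = 0 := by
      have h1 : S⁻¹ * (b * n0 + H * n1) = 0 := by linarith
      exact (mul_eq_zero.1 h1).resolve_left hSi.ne'
    have hn0sq : n0 ^ 2 = invCoeff g e x := by
      rw [invCoeff, eq_div_iff hDpos.ne', hD']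
      linear_combination H * hN1 - (b * n0 + H * n1) * hort
    have hn0' : n0 = Real.sqrt (invCoeff g e x) := by
      rw [← hn0sq, Real.sqrt_sq hn0.le]
    rw [hn0', hκ1] at hcov
    have h1 : christoffel (metricCoeff g e) 0 1 1 x * H⁻¹
        = 3 / 4 * invCoeff g e x / x 0 := by
      rw [← hSS, ← Real.mul_self_sqrt hqpos.le]
      linear_combination -hcov
    field_simp at h1 ⊢
    linarith

end IsAdaptedChart

end Adapted

/-! ### Construction of the normal form -/

theorem partialDeriv_comp_real {F : ℝ → ℝ} {k : Plane → ℝ} {x : Plane} {F' : ℝ}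
    (hF : HasDerivAt F F' (k x)) (hk : DifferentiableAt ℝ k x) (i : Fin 2) :
    partialDeriv i (fun y => F (k y)) x = F' * partialDeriv i k x := by
  have h1 := hF.comp_hasFDerivAt x hk.hasFDerivAt
  exact partialDeriv_eq_of_hasFDerivAt h1 i

theorem partialDeriv_coord (i a : Fin 2) (x : Plane) :
    partialDeriv i (fun y : Plane => y a) x = if a = i then 1 else 0 := by
  refine (partialDeriv_eq_of_hasFDerivAt
    (EuclideanSpace.proj a : Plane →L[ℝ] ℝ).hasFDerivAt i).trans ?_
  simp

/-- A ball contains, with a point, the point with the same first coordinate and the second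
coordinate of the center. -/
theorem mem_ball_of_fst {y z : Plane} {r : ℝ} (hy : y ∈ Metric.ball z r) :
    (!₂[y 0, z 1] : Plane) ∈ Metric.ball z r := by
  rw [mem_ball_iff_norm] at hy ⊢
  have h1 : (!₂[y 0, z 1] : Plane) - z = EuclideanSpace.single 0 ((y - z) 0) := by
    ext i; fin_cases i <;> simp
  rw [h1, PiLp.norm_single]
  exact (PiLp.norm_apply_le (y - z) 0).trans_lt hy

/-- On a ball, a function with `∂h/∂x¹ = 0` depends on the first coordinate only. -/
theorem eq_of_partialDeriv_eq_zero {h : Plane → ℝ} {z : Plane} {r : ℝ}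
    (hd : ∀ y ∈ Metric.ball z r, DifferentiableAt ℝ h y)
    (h0 : ∀ y ∈ Metric.ball z r, partialDeriv 1 h y = 0) {y : Plane}
    (hy : y ∈ Metric.ball z r) : h y = h !₂[y 0, z 1] := by
  set ℓ : ℝ → Plane := fun t => !₂[y 0, z 1 + t * (y 1 - z 1)] with hℓ
  have hmem : ∀ t ∈ Icc (0 : ℝ) 1, ℓ t ∈ Metric.ball z r := by
    intro t ht
    have h1 : ℓ t = !₂[y 0, z 1] + t • (y - !₂[y 0, z 1]) := by
      ext i; fin_cases i <;> simp [hℓ]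
    rw [h1]
    exact (convex_ball z r).add_smul_sub_mem (mem_ball_of_fst hy) hy ht
  have hder : ∀ t ∈ Icc (0 : ℝ) 1, HasDerivAt (fun t => h (ℓ t)) 0 t := by
    intro t ht
    have h1 := hasDerivAt_comp_plane (c := ℓ) (c' := ![0, y 1 - z 1]) (hd _ (hmem t ht)) (by
      intro k
      fin_cases k
      · simpa [hℓ] using hasDerivAt_const t (y 0)
      · simpa [hℓ] using ((hasDerivAt_id t).mul_const (y 1 - z 1)).const_add (z 1))
    simpa [h0 _ (hmem t ht)] using h1
  have h1 := constant_of_has_deriv_right_zero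
    (fun t ht => (hder t ht).continuousAt.continuousWithinAt)
    (fun t ht => (hder t (Ico_subset_Icc_self ht)).hasDerivWithinAt) 1 (right_mem_Icc.2 zero_le_one)
  have e1 : ℓ 1 = y := by ext i; fin_cases i <;> simp [hℓ]
  have e0 : ℓ 0 = !₂[y 0, z 1] := by ext i; fin_cases i <;> simp [hℓ]
  rwa [e1, e0] at h1

section Main

variable {M : Type*} [TopologicalSpace M] [ChartedSpace Plane M] [IsManifold (𝓡 2) ∞ M]
  {g : SurfaceMetric M} {c : ℝ} {e : OpenPartialHomeomorph M Plane}

namespace IsAdaptedChart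

/-- The circle condition says that `x^(3/4) (√H dy + b/√H dx)` is closed, where `b = g₀₁` and
`H = g₁₁`. -/
theorem form_closed (h : IsAdaptedChart g c e) (hB : HasCircularLevelCurves g c)
    {x : Plane} (hx : x ∈ e.target) :
    partialDeriv 1 (fun y => y 0 ^ (3 / 4 : ℝ)
      * (metricCoeff g e y 0 1 * (Real.sqrt (metricCoeff g e y 1 1))⁻¹)) x
    = partialDeriv 0 (fun y => y 0 ^ (3 / 4 : ℝ) * Real.sqrt (metricCoeff g e y 1 1)) x := by
  have hx0 := h.pos hx
  have hHpos := (h.metric_smooth.pos x hx).2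
  have hDpos := h.metric_smooth.det_pos x hx
  have hsH := Real.sqrt_pos.2 hHpos
  have hΓ := (h.circle_consequences hB hx).2
  have hGd := h.metric_smooth.matDiffAt hx
  have hw : HasDerivAt (fun s : ℝ => s ^ (3 / 4 : ℝ)) (3 / 4 * (x 0 ^ (3 / 4 : ℝ) / x 0)) (x 0) := by
    have := Real.hasDerivAt_rpow_const (x := x 0) (p := 3 / 4) (Or.inl hx0.ne')
    rwa [Real.rpow_sub_one hx0.ne'] at this
  have hcoord : DifferentiableAt ℝ (fun y : Plane => y 0) x :=
    (EuclideanSpace.proj (0 : Fin 2) : Plane →L[ℝ] ℝ).differentiableAt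
  have hwd : DifferentiableAt ℝ (fun y : Plane => y 0 ^ (3 / 4 : ℝ)) x :=
    hcoord.rpow_const (Or.inl hx0.ne')
  have hSd : DifferentiableAt ℝ (fun y => Real.sqrt (metricCoeff g e y 1 1)) x :=
    (hGd 1 1).sqrt hHpos.ne'
  have hSid : DifferentiableAt ℝ (fun y => (Real.sqrt (metricCoeff g e y 1 1))⁻¹) x :=
    hSd.inv hsH.ne'
  have hpw := fun i => partialDeriv_comp_fst hw i
  have hpS := fun i => partialDeriv_comp_real
    (k := fun y => metricCoeff g e y 1 1) (Real.hasDerivAt_sqrt hHpos.ne') (hGd 1 1) i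
  have hpSi := fun i => partialDeriv_comp_real (hasDerivAt_inv hsH.ne') hSd i
  rw [partialDeriv_mul 1 hwd ((hGd 0 1).fun_mul hSid), partialDeriv_mul 1 (hGd 0 1) hSid,
    partialDeriv_mul 0 hwd hSd, hpw, hpw, hpSi, hpS, hpS]
  simp only [one_ne_zero, if_false, if_true, zero_mul, zero_add]
  -- Express `Γ⁰₁₁` by the derivatives of the metric.
  have hfk : ∀ l, (metricCoeff g e x * connMat (metricCoeff g e) 1 x) l 1 = _ := fun l =>
    congrFun (congrFun (h.metric_smooth.metric_mul_connMat hx 1) l) 1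
  have hf0 := hfk 0
  have hf1 := hfk 1
  have hD' := Matrix.det_fin_two (metricCoeff g e x)
  simp only [Matrix.mul_apply, Fin.sum_univ_two, firstKind, Matrix.of_apply, h.offDiag_symm]
    at hf0 hf1 hD'
  have hconn : connMat (metricCoeff g e) 1 x 0 1 = christoffel (metricCoeff g e) 0 1 1 x := rfl
  rw [hconn, hΓ, invCoeff] at hf0 hf1
  set b := metricCoeff g e x 0 1
  set H := metricCoeff g e x 1 1 with hH
  set D := (metricCoeff g e x).det
  set S := Real.sqrt H with hS
  have hSS : H = S * S := (Real.mul_self_sqrt hHpos.le).symm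
  have key : H * (partialDeriv 1 (fun y => metricCoeff g e y 0 1) x
      - 1 / 2 * partialDeriv 0 (fun y => metricCoeff g e y 1 1) x)
      - 1 / 2 * b * partialDeriv 1 (fun y => metricCoeff g e y 1 1) x
      = 3 / 4 * H ^ 2 / x 0 := by
    have h1 : D * (3 / 4 * (H / D) * H / x 0) = 3 / 4 * H ^ 2 / x 0 := by
      field_simp
    rw [← h1]
    linear_combination b * hf1 - H * hf0 - 3 / 4 * (H / D) * H / x 0 * hD'
  set B1 := partialDeriv 1 (fun y => metricCoeff g e y 0 1) x
  set H0 := partialDeriv 0 (fun y => metricCoeff g e y 1 1) x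
  set H1 := partialDeriv 1 (fun y => metricCoeff g e y 1 1) x
  rw [hSS] at key
  field_simp at key ⊢
  linear_combination key

end IsAdaptedChart

/-- If the level curves of `K` are circles of the prescribed curvature, then the surface has the
normal form around every point. -/
theorem hasNormalFormAt_of_hasCircularLevelCurves (hM : IsOrientedAtlas M)
    (hB : HasCircularLevelCurves g c) (p : M) : HasNormalFormAt g c p := by
  obtain ⟨F, hF, -⟩ := hB.2.2
  obtain ⟨e, r, hr, h, hp, ht⟩ := exists_isAdaptedChart hM hF hB.2.1 p
  have hG := h.metric_smooth
  have hqs := h.invCoeff_contDiffOn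
  have hx0s : ContDiff ℝ ∞ (fun y : Plane => y 0) :=
    (EuclideanSpace.proj (0 : Fin 2) : Plane →L[ℝ] ℝ).contDiff
  have hws : ContDiffOn ℝ ∞ (fun y : Plane => y 0 ^ (3 / 4 : ℝ)) e.target :=
    hx0s.contDiffOn.rpow_const_of_ne fun y hy => (h.pos hy).ne'
  have hSs : ContDiffOn ℝ ∞ (fun y => Real.sqrt (metricCoeff g e y 1 1)) e.target :=
    (hG.smooth 1 1).sqrt fun y hy => (hG.pos y hy).2.ne'
  have hS0 : ∀ y ∈ e.target, 0 < Real.sqrt (metricCoeff g e y 1 1) := fun y hy =>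
    Real.sqrt_pos.2 (hG.pos y hy).2
  have hq0 : ∀ y ∈ e.target, 0 < Real.sqrt (IsAdaptedChart.invCoeff g e y) := fun y hy =>
    Real.sqrt_pos.2 (h.invCoeff_pos hy)
  -- The coordinate `u` with `du = dx / |dx|`.
  obtain ⟨u, hus, hu⟩ := exists_primitive (z := e p) (r := r)
    (a := fun y => (Real.sqrt (IsAdaptedChart.invCoeff g e y))⁻¹) (b := fun _ => 0)
    (by
      rw [← ht]
      exact (hqs.sqrt fun y hy => (h.invCoeff_pos hy).ne').inv fun y hy => (hq0 y hy).ne')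
    contDiffOn_const (by
      rw [← ht]
      intro x hx
      have hqd := differentiableAt_of_contDiffOn e.open_target hqs hx
      rw [partialDeriv_const, partialDeriv_comp_real (hasDerivAt_inv (hq0 x hx).ne')
        (hqd.sqrt (h.invCoeff_pos hx).ne'),
        partialDeriv_comp_real (Real.hasDerivAt_sqrt (h.invCoeff_pos hx).ne') hqd,
        (h.circle_consequences hB hx).1, mul_zero, mul_zero])
  -- The coordinate `v` with `dv = x^(3/4) (√H dy + b/√H dx)`.
  obtain ⟨v, hvs, hv⟩ := exists_primitive (z := e p) (r := r)
    (a := fun y => y 0 ^ (3 / 4 : ℝ)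
      * (metricCoeff g e y 0 1 * (Real.sqrt (metricCoeff g e y 1 1))⁻¹))
    (b := fun y => y 0 ^ (3 / 4 : ℝ) * Real.sqrt (metricCoeff g e y 1 1))
    (by rw [← ht]; exact hws.mul ((hG.smooth 0 1).mul (hSs.inv fun y hy => (hS0 y hy).ne')))
    (by rw [← ht]; exact hws.mul hSs)
    (by rw [← ht]; exact fun x hx => h.form_closed hB hx)
  rw [← ht] at hus hvs hu hv
  set Ψ : Plane → Plane := fun y => !₂[u y, v y] with hΨ
  have hΨs : ContDiffOn ℝ ∞ Ψ e.target := by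
    rw [contDiffOn_euclidean]
    intro i
    fin_cases i
    · simpa [hΨ] using hus
    · simpa [hΨ] using hvs
  have hjac : ∀ x ∈ e.target, jac Ψ x
      = !![(Real.sqrt (IsAdaptedChart.invCoeff g e x))⁻¹, 0;
        x 0 ^ (3 / 4 : ℝ) * (metricCoeff g e x 0 1 * (Real.sqrt (metricCoeff g e x 1 1))⁻¹),
        x 0 ^ (3 / 4 : ℝ) * Real.sqrt (metricCoeff g e x 1 1)] := by
    intro x hx
    have h0 : (fun y => Ψ y 0) = u := by ext; simp [hΨ]
    have h1 : (fun y => Ψ y 1) = v := by ext; simp [hΨ]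
    ext a i
    fin_cases a <;> fin_cases i <;> simp [jac, h0, h1, hu x hx, hv x hx]
  have hdet : 0 < (jac Ψ (e p)).det := by
    have hx := e.map_source hp
    have h1 := hq0 _ hx
    have h2 := hS0 _ hx
    have h3 := h.pos hx
    rw [hjac _ hx, Matrix.det_fin_two_of, zero_mul, sub_zero]
    positivity
  obtain ⟨e', r', hr', he', hpe', ht', hprop⟩ := exists_chart_comp h.positive hp e.open_target
    (e.map_source hp) hΨs hdet
  set z := Ψ (e p) with hz
  have hP := isPullback_transition g h.positive.1 he'.1
  have hP' := isPullback_transition g he'.1 h.positive.1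
  set θ := transition e' e with hθ
  have hsrc : ∀ y ∈ e'.target, y ∈ (e'.symm ≫ₕ e).source := fun y hy =>
    ⟨hy, (hprop _ (e'.map_target hy)).1⟩
  have hθt : ∀ y ∈ e'.target, θ y ∈ e.target := fun y hy => hP'.mapsTo (hsrc y hy)
  have hθov : ∀ y ∈ e'.target, θ y ∈ (e.symm ≫ₕ e').source := fun y hy =>
    mem_overlap (hprop _ (e'.map_target hy)).1 (e'.map_target hy)
  have hinv : ∀ y ∈ e'.target, transition e e' (θ y) = y := by
    intro y hy
    rw [hθ, transition, transition, e.left_inv (hprop _ (e'.map_target hy)).1, e'.right_inv hy]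
  have hjt : ∀ y ∈ e'.target, jac (transition e e') (θ y) = jac Ψ (θ y) := by
    intro y hy
    have hev : transition e e' =ᶠ[nhds (θ y)] Ψ := by
      filter_upwards [(e.symm ≫ₕ e').open_source.mem_nhds (hθov y hy)] with w hw
      have h1 : e' (e.symm w) = Ψ (e (e.symm w)) := (hprop _ hw.2).2.2.2
      rw [e.right_inv hw.1] at h1
      exact h1
    ext a i
    exact partialDeriv_congr i (hev.fun_comp fun v => v a)
  have hjinv : ∀ y ∈ e'.target, jac Ψ (θ y) * jac θ y = 1 := by
    intro y hy
    rw [← hjt y hy, ← jac_comp (hP.diffAt (hθov y hy)) (hP'.diffAt (hsrc y hy))]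
    have hev : (fun w => transition e e' (θ w)) =ᶠ[nhds y] fun w => w := by
      filter_upwards [e'.open_target.mem_nhds hy] with w hw using hinv w hw
    ext a i
    have h1 := partialDeriv_congr i (hev.fun_comp fun v => v a)
    refine h1.trans ?_
    rw [Matrix.one_apply]
    exact partialDeriv_coord i a y
  -- The coordinate `x` as a function of `(u, v)`.
  have hθ0 : ∀ y ∈ e'.target,
      partialDeriv 0 (fun y => θ y 0) y = Real.sqrt (IsAdaptedChart.invCoeff g e (θ y)) ∧
      partialDeriv 1 (fun y => θ y 0) y = 0 := by
    intro y hy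
    have h1 := hjinv y hy
    rw [hjac _ (hθt y hy)] at h1
    have hq := hq0 _ (hθt y hy)
    have h00 := congrFun (congrFun h1 0) 0
    have h01 := congrFun (congrFun h1 0) 1
    simp only [Matrix.mul_apply, Fin.sum_univ_two, Matrix.of_apply, Matrix.cons_val_zero,
      Matrix.cons_val_one, zero_mul, add_zero, Matrix.one_apply_eq] at h00 h01
    constructor
    · have : jac θ y 0 0 = Real.sqrt (IsAdaptedChart.invCoeff g e (θ y)) := by
        field_simp at h00; exact h00
      exact this
    · have : jac θ y 0 1 = 0 := by
        simpa [hq.ne'] using h01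
      exact this
  have hθs : ContDiffOn ℝ ∞ (fun y => θ y 0) e'.target :=
    (hP'.smooth_coord 0).mono hsrc
  have hθd : ∀ y ∈ e'.target, DifferentiableAt ℝ (fun y => θ y 0) y := fun y hy =>
    differentiableAt_of_contDiffOn e'.open_target hθs hy
  set f : ℝ → ℝ := fun s => θ !₂[s, z 1] 0 with hf
  have hbase : ∀ y ∈ e'.target, (!₂[y 0, z 1] : Plane) ∈ e'.target := by
    intro y hy; rw [ht'] at hy ⊢; exact mem_ball_of_fst hy
  have hfθ : ∀ y ∈ e'.target, θ y 0 = f (y 0) := by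
    intro y hy
    rw [ht'] at hθ0 hθd hy
    exact eq_of_partialDeriv_eq_zero hθd (fun y hy => (hθ0 y hy).2) hy
  have hfd : ∀ y ∈ e'.target, HasDerivAt f
      (Real.sqrt (IsAdaptedChart.invCoeff g e (θ !₂[y 0, z 1]))) (y 0) := by
    intro y hy
    have h1 := hasDerivAt_comp_plane (h := fun y => θ y 0) (c := fun s => !₂[s, z 1])
      (c' := ![1, 0]) (hθd _ (hbase y hy)) (by
        intro k
        fin_cases k
        · simpa using hasDerivAt_id' (y 0)
        · simpa using hasDerivAt_const (y 0) (z 1))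
    simpa [(hθ0 _ (hbase y hy)).1] using h1
  have hfs : ContDiffOn ℝ ∞ f ((fun x : Plane => x 0) '' e'.target) := by
    have hline : ContDiff ℝ ∞ (fun s : ℝ => (!₂[s, z 1] : Plane)) := by
      rw [contDiff_euclidean]
      intro i
      fin_cases i
      · exact (contDiff_id : ContDiff ℝ ∞ fun s : ℝ => s)
      · simpa using contDiff_const
    refine hθs.comp hline.contDiffOn ?_
    rintro _ ⟨y, hy, rfl⟩
    exact hbase y hy
  have hfpos : ∀ y ∈ e'.target, 0 < f (y 0) := fun y hy => by
    rw [← hfθ y hy]; exact h.pos (hθt y hy)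
  -- Both sides have the same pull-back to the chart `e`.
  have hmetric : ∀ y ∈ e'.target, metricCoeff g e' y = !![1, 0; 0, warp f (y 0)] := by
    intro y hy
    have h1 := hP.eq (θ y) (hθov y hy)
    rw [hinv y hy, hjt y hy] at h1
    have hJu : IsUnit (jac Ψ (θ y)) := by
      rw [Matrix.isUnit_iff_isUnit_det, ← hjt y hy]; exact hP.isUnit_jac (hθov y hy)
    have hJtu : IsUnit (jac Ψ (θ y))ᵀ := by
      rw [Matrix.isUnit_iff_isUnit_det, Matrix.det_transpose, ← Matrix.isUnit_iff_isUnit_det]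
      exact hJu
    have h2 : metricCoeff g e (θ y)
        = (jac Ψ (θ y))ᵀ * !![1, 0; 0, warp f (y 0)] * jac Ψ (θ y) := by
      have hx := hθt y hy
      have hx0 := h.pos hx
      have hH := (hG.pos _ hx).2
      have hS := hS0 _ hx
      have hq := hq0 _ hx
      have hD := hG.det_pos _ hx
      have hD' := Matrix.det_fin_two (metricCoeff g e (θ y))
      rw [h.offDiag_symm] at hD'
      have hw : warp f (y 0) * ((θ y 0) ^ (3 / 4 : ℝ)) ^ 2 = 1 := by
        have : 0 < (θ y 0) ^ (3 / 2 : ℝ) := by positivity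
        rw [warp, ← hfθ y hy, ← Real.rpow_natCast, ← Real.rpow_mul hx0.le]
        norm_num
        exact inv_mul_cancel₀ this.ne'
      have hSS : Real.sqrt (metricCoeff g e (θ y) 1 1) ^ 2 = metricCoeff g e (θ y) 1 1 :=
        Real.sq_sqrt hH.le
      have hqq : Real.sqrt (IsAdaptedChart.invCoeff g e (θ y)) ^ 2
        = metricCoeff g e (θ y) 1 1 / (metricCoeff g e (θ y)).det :=
        Real.sq_sqrt (h.invCoeff_pos hx).le
      rw [hjac _ hx]
      have hoff := h.offDiag_symm (θ y)
      set S := Real.sqrt (metricCoeff g e (θ y) 1 1)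
      set Q := Real.sqrt (IsAdaptedChart.invCoeff g e (θ y))
      set W := (θ y 0) ^ (3 / 4 : ℝ)
      set E := metricCoeff g e (θ y) 0 0 with hE
      set b := metricCoeff g e (θ y) 0 1 with hb
      set H := metricCoeff g e (θ y) 1 1 with hHdef
      have hSi : S⁻¹ ^ 2 = H⁻¹ := by rw [inv_pow, hSS]
      have hQi : Q⁻¹ ^ 2 = (E * H - b * b) / H := by rw [inv_pow, hqq, hD', inv_div]
      have e00 : E = Q⁻¹ * Q⁻¹ + W * (b * S⁻¹) * warp f (y 0) * (W * (b * S⁻¹)) := by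
        have : Q⁻¹ * Q⁻¹ + W * (b * S⁻¹) * warp f (y 0) * (W * (b * S⁻¹))
            = Q⁻¹ ^ 2 + warp f (y 0) * W ^ 2 * b ^ 2 * S⁻¹ ^ 2 := by ring
        rw [this, hw, hSi, hQi]
        field_simp
        ring
      have e01 : b = W * (b * S⁻¹) * warp f (y 0) * (W * S) := by
        have : W * (b * S⁻¹) * warp f (y 0) * (W * S)
            = warp f (y 0) * W ^ 2 * b * (S⁻¹ * S) := by ring
        rw [this, hw, inv_mul_cancel₀ hS.ne']
        ring
      have e11 : H = W * S * warp f (y 0) * (W * S) := by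
        have : W * S * warp f (y 0) * (W * S) = warp f (y 0) * W ^ 2 * S ^ 2 := by ring
        rw [this, hw, hSS, one_mul]
      ext i j
      fin_cases i <;> fin_cases j
      · simpa [Matrix.mul_apply, Fin.sum_univ_two] using e00
      · simpa [Matrix.mul_apply, Fin.sum_univ_two] using e01
      · simp [Matrix.mul_apply, Fin.sum_univ_two, hoff]
        linear_combination e01
      · simpa [Matrix.mul_apply, Fin.sum_univ_two] using e11
    rw [h1] at h2
    exact hJtu.mul_left_cancel (hJu.mul_right_cancel h2)
  have hopen := isOpen_fst_image e'.open_target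
  have hfd' : ∀ y ∈ e'.target, HasDerivAt f (deriv f (y 0)) (y 0) := fun y hy => by
    rw [(hfd y hy).deriv]; exact hfd y hy
  refine hasNormalFormAt_iff.2 ⟨e', f, hpe', he', ⟨hfs, ?_, ?_, ?_⟩, hmetric⟩
  · rintro _ ⟨y, hy, rfl⟩
    exact hfpos y hy
  · rintro _ ⟨y, hy, rfl⟩
    simp only
    rw [(hfd y hy).deriv]
    exact hq0 _ (hθt _ (hbase y hy))
  · rintro _ ⟨y, hy, rfl⟩
    have hd2 : HasDerivAt (deriv f) (deriv (deriv f) (y 0)) (y 0) :=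
      (((hfs.deriv_of_isOpen hopen (m := ∞) (by simp)).contDiffAt
        (hopen.mem_nhds ⟨y, hy, rfl⟩)).differentiableAt (by simp)).hasDerivAt
    have h1 := curvature_warp e'.open_target hmetric hfpos hfd' hy hd2
    have h2 := h.curvature_eq (hθt y hy)
    have h3 : e.symm (θ y) = e'.symm y := by
      rw [hθ, transition, e.left_inv (hprop _ (e'.map_target hy)).1]
    have h5 : gaussianCurvature g (e'.symm y) = _ := gaussianCurvature_symm_eqOn g he'.1 hy
    rw [h3, h5, h1, hfθ y hy] at h2
    have h4 := hfpos y hy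
    simp only
    field_simp at h2
    linear_combination (1 / 48) * h2

end Main

end BiconservativeSurface

end

theorem mainTheorem6 {M : Type*} [TopologicalSpace M] [T2Space M] [SecondCountableTopology M]
    [ConnectedSpace M] [ChartedSpace BiconservativeSurface.Plane M] [IsManifold (𝓡 2) ∞ M]
    (hM : BiconservativeSurface.IsOrientedAtlas M)
    (g : BiconservativeSurface.SurfaceMetric M) :
    (∀ c : ℝ, c ≠ 0 →
      ((∀ p : M, BiconservativeSurface.HasNormalFormAt g c p) ↔
        BiconservativeSurface.HasCircularLevelCurves g c)) ∧
    ((∀ p : M, ∃ c : ℝ, c ≠ 0 ∧ BiconservativeSurface.HasNormalFormAt g c p) ↔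
      ∃ c : ℝ, c ≠ 0 ∧ BiconservativeSurface.HasCircularLevelCurves g c) := by
  have key : ∀ c : ℝ, (∀ p : M, BiconservativeSurface.HasNormalFormAt g c p) ↔
      BiconservativeSurface.HasCircularLevelCurves g c := fun c =>
    ⟨BiconservativeSurface.hasCircularLevelCurves_of_hasNormalFormAt,
      BiconservativeSurface.hasNormalFormAt_of_hasCircularLevelCurves hM⟩
  refine ⟨fun c _ => key c, fun h => ?_, fun ⟨c, hc, h⟩ p => ⟨c, hc, (key c).2 h p⟩⟩
  obtain ⟨c, hc, hN⟩ := BiconservativeSurface.exists_hasNormalFormAt_const h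
  exact ⟨c, hc, (key c).1 hN⟩
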